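/- Let $0<r<1$, $\alpha>0$ and $\beta\in\mathbb{R}$. Let $C^{\alpha,r}_{\beta,\infty}$ be the set of all $2\pi$-periodic functions $f$ that can be represented for all $x\in\mathbb{R}$ in the form $$f(x)=\frac{a_0}{2}+\frac1\pi\int_{-\pi}^{\pi}P_{\alpha,r,\beta}(x-t)\varphi(t)\,dt,\qquad P_{\alpha,r,\beta}(t)=\sum_{k=1}^{\infty}e^{-\alpha k^{r}}\cos\Big(kt-\frac{\beta\pi}{2}\Big),$$ where $a_0\in\mathbb{R}$ and $\varphi$ is a measurable $2\pi$-periodic function with $\operatorname{ess\,sup}_t|\varphi(t)|\le 1$ and $\int_{-\pi}^{\pi}\varphi(t)\,dt=0$. For $n\in\mathbb{N}$, $n\ge 1$, put $$\mathcal{E}_n(C^{\alpha,r}_{\beta,\infty})_C=\sup_{f\in C^{\alpha,r}_{\beta,\infty}}\ \max_{x\in\mathbb{R}}|f(x)-S_{n-1}(f;x)|,$$ where $S_{n-1}(f;\cdot)$ is the partial Fourier sum of order $n-1$ of $f$. Let $n_1=n_1(\alpha,r)$ be the smallest positive integer $n$ such that $$\frac{1}{\alpha r}\,\frac{1}{n^{r}}\Big(1+\ln\Big(\frac{\pi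 n^{1-r}}{\alpha r}\Big)\Big)+\frac{\alpha r}{n^{1-r}}\le\frac{1}{(3\pi)^3}.$$ Then for every integer $n\ge n_1(\alpha,r)$ the quantity $\mathcal{E}_n(C^{\alpha,r}_{\beta,\infty})_C$ is finite and $$\mathcal{E}_n(C^{\alpha,r}_{\beta,\infty})_C=\frac{4}{\pi^2}\,e^{-\alpha n^{r}}\ln\Big(\frac{\pi n^{1-r}}{\alpha r}\Big)+\gamma\,e^{-\alpha n^{r}},$$ where the quantity $\gamma=\gamma_n(\alpha,r,\beta)$ satisfies $|\gamma|\le 20\pi^4$. -/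

import Mathlib

open MeasureTheory Filter
open scoped Real ENNReal

namespace FourierApprox

/-- The generalized Poisson kernel
`P_{α,r,β}(t) = ∑_{k ≥ 1} exp (-α k ^ r) cos (k t - β π / 2)`
(an absolutely convergent series for `α, r > 0`). -/
noncomputable def poissonKernel (α r β t : ℝ) : ℝ :=
  ∑' k : ℕ, Real.exp (-α * ((k : ℝ) + 1) ^ r) * Real.cos (((k : ℝ) + 1) * t - β * π / 2)

/-- The set `B_p^0` of `2π`-periodic functions with `‖φ‖_p ≤ 1` over a period and with
mean value zero. -/
def zeroMeanBall (p : ℝ≥0∞) : Set (ℝ → ℝ) :=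
  {φ | Function.Periodic φ (2 * π) ∧
    AEStronglyMeasurable φ (volume.restrict (Set.Ioc (-π) π)) ∧
    eLpNorm φ p (volume.restrict (Set.Ioc (-π) π)) ≤ 1 ∧
    ∫ t in (-π)..π, φ t = 0}

/-- The class `C^{α,r}_{β,p}` of generalized Poisson integrals. -/
def poissonClass (α r β : ℝ) (p : ℝ≥0∞) : Set (ℝ → ℝ) :=
  {f | ∃ a₀ : ℝ, ∃ φ ∈ zeroMeanBall p, ∀ x : ℝ,
    f x = a₀ / 2 + 1 / π * ∫ t in (-π)..π, poissonKernel α r β (x - t) * φ t}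

/-- Cosine Fourier coefficient `a_k(f)`. -/
noncomputable def cosCoeff (f : ℝ → ℝ) (k : ℕ) : ℝ :=
  1 / π * ∫ t in (-π)..π, f t * Real.cos (k * t)

/-- Sine Fourier coefficient `b_k(f)`. -/
noncomputable def sinCoeff (f : ℝ → ℝ) (k : ℕ) : ℝ :=
  1 / π * ∫ t in (-π)..π, f t * Real.sin (k * t)

/-- The partial Fourier sum `S_m(f; x)` of order `m`. -/
noncomputable def fourierSum (m : ℕ) (f : ℝ → ℝ) (x : ℝ) : ℝ :=
  cosCoeff f 0 / 2 +
    ∑ k ∈ Finset.Icc 1 m, (cosCoeff f k * Real.cos (k * x) + sinCoeff f k * Real.sin (k * x))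

/-- The uniform norm `sup_x |g x|`, with values in `[0, ∞]`. -/
noncomputable def uniformNorm (g : ℝ → ℝ) : ℝ≥0∞ :=
  ⨆ x : ℝ, ENNReal.ofReal |g x|

/-- For `n ≥ 1`, the quantity `sup_{f ∈ C^{α,r}_{β,p}} ‖f - S_{n-1}(f)‖_C`, with values
in `[0, ∞]`. -/
noncomputable def fourierError (α r β : ℝ) (p : ℝ≥0∞) (n : ℕ) : ℝ≥0∞ :=
  ⨆ f ∈ poissonClass α r β p, uniformNorm (fun x => f x - fourierSum (n - 1) f x)

/-- The condition on positive integers that defines the threshold. -/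
def ThresholdCond (α r : ℝ) (n : ℕ) : Prop :=
  1 ≤ n ∧
    1 / (α * r) * (1 / (n : ℝ) ^ r) * (1 + Real.log (π * (n : ℝ) ^ (1 - r) / (α * r))) +
      α * r / (n : ℝ) ^ (1 - r) ≤ 1 / (3 * π) ^ 3

/-- The smallest positive integer that satisfies the condition. -/
noncomputable def threshold (α r : ℝ) : ℕ :=
  sInf {n : ℕ | ThresholdCond α r n}

/-- The infimum above is attained, so it is a minimum. -/
theorem threshold_isLeast {α r : ℝ} (hα : 0 < α) (hr : 0 < r) (hr1 : r < 1) :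
    IsLeast {n : ℕ | ThresholdCond α r n} (threshold α r) := by
  have hc : 0 < α * r := mul_pos hα hr
  have h1 : Tendsto (fun x : ℝ => 1 / x ^ r) atTop (nhds 0) := by
    simp only [one_div]
    exact (tendsto_rpow_atTop hr).inv_tendsto_atTop
  have h2 : Tendsto (fun x : ℝ => Real.log x / x ^ r) atTop (nhds 0) :=
    (isLittleO_log_rpow_atTop hr).tendsto_div_nhds_zero
  have h3 : Tendsto (fun x : ℝ => 1 / x ^ (1 - r)) atTop (nhds 0) := by
    simp only [one_div]
    exact (tendsto_rpow_atTop (sub_pos.2 hr1)).inv_tendsto_atTop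
  have h4 := (((h1.const_mul (1 / (α * r) * (1 + Real.log (π / (α * r))))).add
    (h2.const_mul (1 / (α * r) * (1 - r)))).add (h3.const_mul (α * r))).comp
      (tendsto_natCast_atTop_atTop (R := ℝ))
  have hε : (0 : ℝ) < 1 / (3 * π) ^ 3 := by positivity
  have h5 := h4.eventually (eventually_le_nhds (b := 1 / (3 * π) ^ 3) (by simpa using hε))
  obtain ⟨n, hn, hn1⟩ := (h5.and (eventually_ge_atTop 1)).exists
  have hne : {n : ℕ | ThresholdCond α r n}.Nonempty := by
    refine ⟨n, hn1, le_trans (le_of_eq ?_) hn⟩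
    have hn0 : (0 : ℝ) < n := by exact_mod_cast hn1
    have hlog : Real.log (π * (n : ℝ) ^ (1 - r) / (α * r)) =
        Real.log (π / (α * r)) + (1 - r) * Real.log n := by
      rw [mul_div_right_comm, Real.log_mul (by positivity) (by positivity),
        Real.log_rpow hn0]
    rw [hlog]
    simp only [Function.comp]
    ring
  exact ⟨Nat.sInf_mem hne, fun m hm => Nat.sInf_le hm⟩

end FourierApprox

namespace FourierApprox

/-! Write `M = n^(1-r)/(αr)` and `p = αr n^r`, so that `pM = n`. The remainder `f - S_{n-1} f` is
`exp (-α n^r) / π` times the convolution of `φ` with `K(t) = ∑ c_j cos((n+j)t - θ)`, where `θ =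
βπ/2` and `c_j = exp (-α((n+j)^r - n^r))` (`sub_fourierSum_eq`). Everything reduces to the L¹ norm
of `K` over a period, up to a bounded error.

The `c_j` decrease convexly from 1 with first drop at most `1/M`. Two Abel summations then compare
`K` with the kernel of a geometric series: for `0 < t ≤ π`, `K(t) = -sin((n-1/2)t - θ)/t` up to
`π²/(2M t²) + 1` (`abs_tailKernel_add_div_le`). This error has bounded integral over `[1/M, π]`, and
on `[0, 1/M]` the bound `|K| ≤ ∑ c_j ≤ 1 + 2M` suffices (`tsum_ratio_le`). Since `|sin|` has mean
`2/π` and the frequency is at least `10M`, the main term integrates to `(2/π) log(πM) + O(1)` on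
each half-period, hence `(4/π) log(πM)` over the period and `4/π²` after the factor `1/π`.

This bounds the error from above because `|φ| ≤ 1`. For the lower bound, `φ` is the sign of the main
term for `|t| ≥ 1/M` and a constant near 0, chosen to make the mean vanish
(`exists_integral_extremalSign_eq_zero`). The threshold serves only to give `p, M ≥ 100`. -/

/-! ### Abel summation on the unit circle -/

lemma summable_ofReal_mul_pow {c : ℕ → ℝ} (hc : Summable c) {z : ℂ} (hz : ‖z‖ = 1) :
    Summable fun j => (c j : ℂ) * z ^ j := by
  refine Summable.of_norm ?_
  simpa [hz] using hc.abs

/-- One Abel summation: the factor `1 - z` replaces the coefficients by their differences. -/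
lemma one_sub_mul_tsum {c : ℕ → ℝ} (hc : Summable c) {z : ℂ} (hz : ‖z‖ = 1) :
    (1 - z) * ∑' j, (c j : ℂ) * z ^ j =
      c 0 - z * ∑' j, ((c j - c (j + 1) : ℝ) : ℂ) * z ^ j := by
  have hs := summable_ofReal_mul_pow hc hz
  have hs1 := summable_ofReal_mul_pow ((summable_nat_add_iff 1).2 hc) hz
  have h1 : ∑' j, ((c j - c (j + 1) : ℝ) : ℂ) * z ^ j =
      ∑' j, (c j : ℂ) * z ^ j - ∑' j, (c (j + 1) : ℂ) * z ^ j := by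
    rw [← hs.tsum_sub hs1]
    congr 1; ext j; push_cast; ring
  have h2 : ∑' j, (c j : ℂ) * z ^ j = c 0 + z * ∑' j, (c (j + 1) : ℂ) * z ^ j := by
    rw [hs.tsum_eq_zero_add, ← tsum_mul_left]
    simp only [pow_zero, mul_one]
    congr 2; ext j; ring
  rw [h1]
  linear_combination h2

lemma tsum_sub_succ {c : ℕ → ℝ} (hc : Summable c) : ∑' j, (c j - c (j + 1)) = c 0 := by
  rw [hc.tsum_sub ((summable_nat_add_iff 1).2 hc), hc.tsum_eq_zero_add]
  ring

/-- A power series with convex summable coefficients is close to a geometric one on the unit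
circle. -/
lemma norm_tsum_sub_le {c : ℕ → ℝ} (hc : Summable c) (hanti : ∀ j, c (j + 1) ≤ c j)
    (hconv : ∀ j, c (j + 1) - c (j + 2) ≤ c j - c (j + 1)) {z : ℂ} (hz : ‖z‖ = 1)
    (hz1 : z ≠ 1) :
    ‖∑' j, (c j : ℂ) * z ^ j - c 0 / (1 - z)‖ ≤ 2 * (c 0 - c 1) / ‖1 - z‖ ^ 2 := by
  have hd : Summable fun j => c j - c (j + 1) := hc.sub ((summable_nat_add_iff 1).2 hc)
  have he : Summable fun j => (c j - c (j + 1)) - (c (j + 1) - c (j + 2)) :=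
    hd.sub ((summable_nat_add_iff 1).2 hd)
  have h1 := one_sub_mul_tsum hc hz
  have h2 := one_sub_mul_tsum hd hz
  -- By convexity the second differences are nonnegative, so their absolute sum telescopes.
  have hE : ‖∑' j, (((c j - c (j + 1)) - (c (j + 1) - c (j + 2)) : ℝ) : ℂ) * z ^ j‖
      ≤ c 0 - c 1 := by
    refine (norm_tsum_le_tsum_norm (summable_ofReal_mul_pow he hz).norm).trans ?_
    have : ∀ j, ‖(((c j - c (j + 1)) - (c (j + 1) - c (j + 2)) : ℝ) : ℂ) * z ^ j‖ =
        (c j - c (j + 1)) - (c (j + 1) - c (j + 2)) := by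
      intro j
      rw [norm_mul, norm_pow, hz, one_pow, mul_one, Complex.norm_real, Real.norm_eq_abs,
        abs_of_nonneg (by linarith [hconv j])]
    simp_rw [this]
    exact (tsum_sub_succ hd).le
  have hne : (1 - z) ≠ 0 := sub_ne_zero.2 hz1.symm
  have hpos : 0 < ‖1 - z‖ := norm_pos_iff.2 hne
  set A := ∑' j, (c j : ℂ) * z ^ j
  set D := ∑' j, ((c j - c (j + 1) : ℝ) : ℂ) * z ^ j
  set F := ∑' j, (((c j - c (j + 1)) - (c (j + 1) - c (j + 2)) : ℝ) : ℂ) * z ^ j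
  have hF : (1 - z) * D = ((c 0 - c 1 : ℝ) : ℂ) - z * F := h2
  have h3 : A - c 0 / (1 - z) = -z * (((c 0 - c 1 : ℝ) : ℂ) - z * F) / (1 - z) ^ 2 := by
    field_simp
    rw [← hF]
    linear_combination (1 - z) * h1
  rw [h3, norm_div, norm_pow, norm_mul, norm_neg, hz, one_mul]
  gcongr
  calc ‖((c 0 - c 1 : ℝ) : ℂ) - z * F‖ ≤ ‖((c 0 - c 1 : ℝ) : ℂ)‖ + ‖z * F‖ := norm_sub_le _ _
    _ ≤ 2 * (c 0 - c 1) := by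
      rw [norm_mul, hz, one_mul, Complex.norm_real, Real.norm_eq_abs,
        abs_of_nonneg (by linarith [hanti 0])]
      linarith

/-! ### The tail kernel and its pointwise asymptotics -/

/-- The phase-shifted cosine series with coefficients `c 0, c 1, …` starting at frequency `n`. -/
noncomputable def tailKernel (c : ℕ → ℝ) (n : ℕ) (θ t : ℝ) : ℝ :=
  ∑' j : ℕ, c j * Real.cos (((n : ℝ) + j) * t - θ)

lemma continuous_tailKernel {c : ℕ → ℝ} (hc : Summable c) (n : ℕ) (θ : ℝ) :
    Continuous (tailKernel c n θ) := by
  refine continuous_tsum (u := fun j => |c j|) (fun j => by fun_prop) hc.abs fun j t => ?_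
  rw [norm_mul, Real.norm_eq_abs, Real.norm_eq_abs]
  exact mul_le_of_le_one_right (abs_nonneg _) (Real.abs_cos_le_one _)

lemma tailKernel_neg (c : ℕ → ℝ) (n : ℕ) (θ t : ℝ) :
    tailKernel c n θ (-t) = tailKernel c n (-θ) t := by
  unfold tailKernel
  congr 1; ext j
  rw [← Real.cos_neg]
  congr 2; ring

lemma tailKernel_periodic (c : ℕ → ℝ) (n : ℕ) (θ : ℝ) :
    Function.Periodic (tailKernel c n θ) (2 * π) := by
  intro t
  unfold tailKernel
  congr 1; ext j
  have : ((n : ℝ) + j) * (t + 2 * π) - θ = (((n : ℝ) + j) * t - θ) + (n + j : ℕ) * (2 * π) := by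
    push_cast; ring
  rw [this, Real.cos_add_nat_mul_two_pi]

lemma abs_tailKernel_le {c : ℕ → ℝ} (hc : Summable c) (h0 : ∀ j, 0 ≤ c j) (n : ℕ) (θ t : ℝ) :
    |tailKernel c n θ t| ≤ ∑' j, c j := by
  rw [← Real.norm_eq_abs]
  refine tsum_of_norm_bounded hc.hasSum fun j => ?_
  rw [norm_mul, Real.norm_eq_abs, Real.norm_eq_abs, abs_of_nonneg (h0 j)]
  exact mul_le_of_le_one_right (h0 j) (Real.abs_cos_le_one _)

lemma tailKernel_eq_re {c : ℕ → ℝ} (hc : Summable c) (n : ℕ) (θ t : ℝ) :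
    tailKernel c n θ t = (Complex.exp ((n * t - θ : ℝ) * Complex.I) *
      ∑' j, (c j : ℂ) * Complex.exp (t * Complex.I) ^ j).re := by
  have hz : ‖Complex.exp (t * Complex.I)‖ = 1 := Complex.norm_exp_ofReal_mul_I t
  rw [← tsum_mul_left, Complex.re_tsum ((summable_ofReal_mul_pow hc hz).mul_left _)]
  unfold tailKernel
  congr 1; ext j
  have : Complex.exp ((n * t - θ : ℝ) * Complex.I) *
      ((c j : ℂ) * Complex.exp (t * Complex.I) ^ j) =
      (c j : ℂ) * Complex.exp (((n + j) * t - θ : ℝ) * Complex.I) := by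
    rw [← Complex.exp_nat_mul, mul_left_comm, ← Complex.exp_add]
    congr 2; push_cast; ring
  rw [this, Complex.re_ofReal_mul, Complex.exp_ofReal_mul_I_re]

lemma one_sub_exp_mul_I (t : ℝ) : 1 - Complex.exp (t * Complex.I) =
    -(2 * Complex.I * Real.sin (t / 2) * Complex.exp ((t / 2 : ℝ) * Complex.I)) := by
  have h : Complex.exp (t * Complex.I) = Complex.exp ((t / 2 : ℝ) * Complex.I) ^ 2 := by
    rw [← Complex.exp_nat_mul]; congr 1; push_cast; ring
  rw [h, Complex.exp_mul_I, ← Complex.ofReal_cos, ← Complex.ofReal_sin]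
  have h2 : (Real.cos (t / 2) : ℂ) ^ 2 + (Real.sin (t / 2) : ℂ) ^ 2 = 1 := by
    exact_mod_cast Real.cos_sq_add_sin_sq (t / 2)
  linear_combination (-1 : ℂ) * h2 + (Real.sin (t / 2) : ℂ) ^ 2 * Complex.I_sq

/-- The geometric main term is explicit: since `1 - e^{it} = -2i sin(t/2) e^{it/2}`, dividing by it
shifts the frequency from `n` to `n - 1/2` and turns the cosine into a sine. -/
lemma abs_tailKernel_add_le {c : ℕ → ℝ} (hc : Summable c) (hanti : ∀ j, c (j + 1) ≤ c j)
    (hconv : ∀ j, c (j + 1) - c (j + 2) ≤ c j - c (j + 1)) (n : ℕ) (θ : ℝ) {t : ℝ}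
    (ht : 0 < Real.sin (t / 2)) :
    |tailKernel c n θ t + c 0 * Real.sin ((n - 1 / 2) * t - θ) / (2 * Real.sin (t / 2))| ≤
      2 * (c 0 - c 1) / (2 * Real.sin (t / 2)) ^ 2 := by
  have hz : ‖Complex.exp (t * Complex.I)‖ = 1 := Complex.norm_exp_ofReal_mul_I t
  have hn : ‖1 - Complex.exp (t * Complex.I)‖ = 2 * Real.sin (t / 2) := by
    rw [one_sub_exp_mul_I, norm_neg, norm_mul, Complex.norm_exp_ofReal_mul_I, norm_mul, norm_mul,
      Complex.norm_I, Complex.norm_real, Real.norm_eq_abs, abs_of_pos ht]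
    simp
  have hne : 1 - Complex.exp (t * Complex.I) ≠ 0 := by
    rw [← norm_pos_iff, hn]; positivity
  have h1 := norm_tsum_sub_le hc hanti hconv hz (sub_ne_zero.1 hne).symm
  rw [hn] at h1
  refine le_trans ?_ h1
  have key : Complex.exp ((n * t - θ : ℝ) * Complex.I) *
      (c 0 / (1 - Complex.exp (t * Complex.I))) =
      ((c 0 / (2 * Real.sin (t / 2)) : ℝ) : ℂ) *
        (Complex.I * Complex.exp (((n - 1 / 2) * t - θ : ℝ) * Complex.I)) := by
    have hs : (Real.sin (t / 2) : ℂ) ≠ 0 := by exact_mod_cast ht.ne'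
    have hx : Complex.exp ((n * t - θ : ℝ) * Complex.I) =
        Complex.exp (((n - 1 / 2) * t - θ : ℝ) * Complex.I) *
          Complex.exp ((t / 2 : ℝ) * Complex.I) := by
      rw [← Complex.exp_add]; congr 1; push_cast; ring
    rw [one_sub_exp_mul_I, hx]
    push_cast at hs ⊢
    have hI : Complex.I ≠ 0 := Complex.I_ne_zero
    have hexp := Complex.exp_ne_zero ((t / 2 : ℂ) * Complex.I)
    field_simp
    linear_combination -(c 0 : ℂ) * Complex.I_sq
  have h2 : tailKernel c n θ t + c 0 * Real.sin ((n - 1 / 2) * t - θ) / (2 * Real.sin (t / 2)) =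
      (Complex.exp ((n * t - θ : ℝ) * Complex.I) *
        (∑' j, (c j : ℂ) * Complex.exp (t * Complex.I) ^ j -
          c 0 / (1 - Complex.exp (t * Complex.I)))).re := by
    rw [mul_sub, Complex.sub_re, ← tailKernel_eq_re hc, key, Complex.re_ofReal_mul,
      Complex.I_mul_re, Complex.exp_ofReal_mul_I_im]
    ring
  rw [h2]
  refine (Complex.abs_re_le_norm _).trans ?_
  rw [norm_mul, Complex.norm_exp_ofReal_mul_I, one_mul]

/-- The bounds `sin(t/2) ≥ (t/2) cos(t/2)` and `cos(t/2) ≥ 1 - t²/8` give `t - 2 sin(t/2) ≤ t³/8`,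
while `2t sin(t/2) ≥ 2t²/π`; the quotient is at most `π²/16`. -/
lemma abs_inv_two_sin_sub_inv_le {t : ℝ} (h0 : 0 < t) (hπ : t ≤ π) :
    |1 / (2 * Real.sin (t / 2)) - 1 / t| ≤ 1 := by
  have hs : 2 / π * (t / 2) ≤ Real.sin (t / 2) := Real.mul_le_sin (by linarith) (by linarith)
  have hs' : t ≤ π * Real.sin (t / 2) := by
    have := mul_le_mul_of_nonneg_left hs Real.pi_pos.le
    calc t = π * (2 / π * (t / 2)) := by field_simp
      _ ≤ _ := this
  have hspos : 0 < Real.sin (t / 2) := by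
    have := Real.pi_pos
    by_contra h
    nlinarith
  have hlt : Real.sin (t / 2) < t / 2 := Real.sin_lt (by linarith)
  have hcos : 1 - (t / 2) ^ 2 / 2 ≤ Real.cos (t / 2) := Real.one_sub_sq_div_two_le_cos
  have hsc : t / 2 * Real.cos (t / 2) ≤ Real.sin (t / 2) := by
    -- The inequality `x < tan x` needs `x < π/2`, so `t = π` is checked separately.
    rcases lt_or_eq_of_le hπ with h | h
    · have h1 := Real.lt_tan (x := t / 2) (by linarith) (by linarith)
      have hc : 0 < Real.cos (t / 2) := Real.cos_pos_of_mem_Ioo ⟨by linarith, by linarith⟩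
      rw [Real.tan_eq_sin_div_cos, lt_div_iff₀ hc] at h1
      exact h1.le
    · rw [h, Real.cos_pi_div_two, Real.sin_pi_div_two]; norm_num
  have hpi := Real.pi_lt_d2
  have hpi0 := Real.pi_pos
  rw [div_sub_div _ _ (by positivity) h0.ne', abs_of_nonneg (div_nonneg (by linarith) (by positivity)),
    div_le_one (by positivity)]
  nlinarith [mul_nonneg h0.le (sub_nonneg.2 hs'), mul_pos h0 h0, mul_pos h0 hspos,
    mul_nonneg (sq_nonneg t) (sub_nonneg.2 hπ)]

lemma abs_tailKernel_add_div_le {c : ℕ → ℝ} (hc : Summable c) (hanti : ∀ j, c (j + 1) ≤ c j)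
    (hconv : ∀ j, c (j + 1) - c (j + 2) ≤ c j - c (j + 1)) (hc0 : c 0 = 1) {M : ℝ}
    (hc1 : c 0 - c 1 ≤ 1 / M) (n : ℕ) (θ : ℝ) {t : ℝ} (h0 : 0 < t) (hπ : t ≤ π) :
    |tailKernel c n θ t + Real.sin ((n - 1 / 2) * t - θ) / t| ≤
      π ^ 2 / (2 * M) * (1 / t ^ 2) + 1 := by
  have hs : 2 / π * (t / 2) ≤ Real.sin (t / 2) := Real.mul_le_sin (by linarith) (by linarith)
  have ht2 : 0 < 2 / π * (t / 2) := by positivity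
  have hspos : 0 < Real.sin (t / 2) := by linarith
  have h1 := abs_tailKernel_add_le hc hanti hconv n θ hspos
  rw [hc0, one_mul] at h1
  have h2 := abs_inv_two_sin_sub_inv_le h0 hπ
  have h3 : 2 * (1 - c 1) / (2 * Real.sin (t / 2)) ^ 2 ≤ π ^ 2 / (2 * M) * (1 / t ^ 2) := by
    calc 2 * (1 - c 1) / (2 * Real.sin (t / 2)) ^ 2
        ≤ 2 * (1 / M) / (2 * (2 / π * (t / 2))) ^ 2 := by
          have := hanti 0
          rw [hc0] at hc1 this
          gcongr
          linarith
      _ = _ := by field_simp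
  have h4 : |Real.sin ((n - 1 / 2) * t - θ) * (1 / (2 * Real.sin (t / 2)) - 1 / t)| ≤ 1 := by
    rw [abs_mul]
    exact mul_le_one₀ (Real.abs_sin_le_one _) (abs_nonneg _) h2
  have h5 : tailKernel c n θ t + Real.sin ((n - 1 / 2) * t - θ) / t =
      (tailKernel c n θ t + Real.sin ((n - 1 / 2) * t - θ) / (2 * Real.sin (t / 2))) -
      Real.sin ((n - 1 / 2) * t - θ) * (1 / (2 * Real.sin (t / 2)) - 1 / t) := by ring
  rw [h5]
  exact (abs_sub _ _).trans (by linarith)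

/-! ### Oscillating integrals with weight `1/t` -/

/-- Whole periods integrate to zero, and what is left is shorter than one period. -/
lemma abs_intervalIntegral_le_of_periodic {g : ℝ → ℝ} {T C : ℝ} (hT : 0 < T)
    (hg : Function.Periodic g T) (hint : ∀ a b, IntervalIntegrable g volume a b)
    (hC : ∀ x, |g x| ≤ C) (h0 : ∫ x in (0)..T, g x = 0) (a b : ℝ) :
    |∫ x in a..b, g x| ≤ C * T := by
  set k := ⌊(b - a) / T⌋
  have h1 : ∫ x in a..(a + k • T), g x = 0 := by
    rw [hg.intervalIntegral_add_zsmul_eq k a hint, hg.intervalIntegral_add_eq a 0, zero_add, h0,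
      smul_zero]
  have h2 := Int.floor_le ((b - a) / T)
  have h3 := Int.lt_floor_add_one ((b - a) / T)
  rw [le_div_iff₀ hT] at h2
  rw [div_lt_iff₀ hT] at h3
  rw [← intervalIntegral.integral_add_adjacent_intervals (hint a (a + k • T)) (hint _ b), h1,
    zero_add]
  have h4 := intervalIntegral.norm_integral_le_of_norm_le_const (a := a + k • T) (b := b)
    (f := g) (C := C) fun x _ => hC x
  rw [Real.norm_eq_abs] at h4
  refine h4.trans (mul_le_mul_of_nonneg_left ?_ ((abs_nonneg _).trans (hC 0)))
  rw [zsmul_eq_mul, abs_le]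
  constructor <;> linarith

lemma integral_one_div_sq {a b : ℝ} (ha : 0 < a) (hab : a ≤ b) :
    ∫ t in a..b, 1 / t ^ 2 = 1 / a - 1 / b := by
  have hpos : ∀ x ∈ Set.uIcc a b, 0 < x := fun x hx => by
    rw [Set.uIcc_of_le hab] at hx; exact ha.trans_le hx.1
  have := intervalIntegral.integral_eq_sub_of_hasDerivAt (a := a) (b := b)
    (f := fun t : ℝ => -t⁻¹) (f' := fun t => 1 / t ^ 2)
    (fun x hx => by
      have := (hasDerivAt_inv (hpos x hx).ne').neg
      rw [neg_neg] at this
      rw [one_div]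
      exact this)
    (ContinuousOn.intervalIntegrable fun x hx =>
      (by have := (hpos x hx).ne'; fun_prop (disch := positivity) :
        ContinuousAt (fun t : ℝ => 1 / t ^ 2) x).continuousWithinAt)
  rw [this]
  ring

lemma intervalIntegrable_one_div_sq {a b : ℝ} (ha : 0 < a) (hab : a ≤ b) :
    IntervalIntegrable (fun t : ℝ => 1 / t ^ 2) volume a b := by
  refine ContinuousOn.intervalIntegrable fun x hx => ?_
  rw [Set.uIcc_of_le hab] at hx
  have : x ≠ 0 := (ha.trans_le hx.1).ne'
  exact (by fun_prop (disch := positivity) :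
    ContinuousAt (fun t : ℝ => 1 / t ^ 2) x).continuousWithinAt

lemma intervalIntegrable_div_self {g : ℝ → ℝ} (hg : Continuous g) {a b : ℝ} (ha : 0 < a)
    (hab : a ≤ b) : IntervalIntegrable (fun t : ℝ => g t / t) volume a b := by
  refine ContinuousOn.intervalIntegrable fun x hx => ?_
  rw [Set.uIcc_of_le hab] at hx
  have : x ≠ 0 := (ha.trans_le hx.1).ne'
  exact (hg.continuousAt.div continuousAt_id this).continuousWithinAt

/-- Integration by parts moves the derivative onto `1/t`; the boundary term `B/b` and the integral
`B(1/a - 1/b)` add up to `B/a`. -/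
lemma abs_integral_div_le {g : ℝ → ℝ} (hg : Continuous g) {a b B : ℝ} (ha : 0 < a) (hab : a ≤ b)
    (hB : ∀ x, |∫ t in a..x, g t| ≤ B) : |∫ t in a..b, g t / t| ≤ B / a := by
  have hpos : ∀ x ∈ Set.uIcc a b, 0 < x := fun x hx => by
    rw [Set.uIcc_of_le hab] at hx; exact ha.trans_le hx.1
  have hq := intervalIntegrable_one_div_sq ha hab
  have hG : ∀ x, HasDerivAt (fun x => ∫ t in a..x, g t) (g x) x := fun x =>
    intervalIntegral.integral_hasDerivAt_right (hg.intervalIntegrable _ _)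
      (hg.stronglyMeasurableAtFilter _ _) hg.continuousAt
  have hp := intervalIntegral.integral_mul_deriv_eq_deriv_mul (a := a) (b := b)
    (u := fun t : ℝ => t⁻¹) (u' := fun t => -(1 / t ^ 2)) (v := fun x => ∫ t in a..x, g t) (v' := g)
    (fun x hx => by
      simpa only [one_div] using hasDerivAt_inv (hpos x hx).ne')
    (fun x _ => hG x) hq.neg (hg.intervalIntegrable _ _)
  have he : ∫ t in a..b, g t / t = ∫ t in a..b, t⁻¹ * g t := by
    congr 1; ext t; ring
  rw [he, hp, intervalIntegral.integral_same, mul_zero, sub_zero]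
  have hb : 0 < b := ha.trans_le hab
  have h1 : |b⁻¹ * ∫ t in a..b, g t| ≤ B * (1 / b) := by
    rw [abs_mul, abs_of_pos (inv_pos.2 hb), mul_comm, one_div]
    exact mul_le_mul_of_nonneg_right (hB b) (inv_pos.2 hb).le
  have h2 : |∫ x in a..b, -(1 / x ^ 2) * ∫ t in a..x, g t| ≤ B * (1 / a - 1 / b) := by
    rw [← integral_one_div_sq ha hab, ← intervalIntegral.integral_const_mul, ← Real.norm_eq_abs]
    refine intervalIntegral.norm_integral_le_of_norm_le hab (ae_of_all _ fun x _ => ?_)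
      (hq.const_mul B)
    rw [norm_mul, norm_neg, Real.norm_eq_abs, Real.norm_eq_abs, abs_of_nonneg (by positivity),
      mul_comm]
    exact mul_le_mul_of_nonneg_right (hB x) (by positivity)
  refine (abs_sub _ _).trans ((add_le_add h1 h2).trans (le_of_eq ?_))
  ring

/-- After subtraction of its mean `2/π`, `|sin|` is `π`-periodic with mean zero, so at frequency `N`
its primitives are bounded by `π/N`. -/
lemma abs_integral_abs_sin_div_sub_le {N a b : ℝ} (θ : ℝ) (hN : 0 < N) (ha : 0 < a)
    (hab : a ≤ b) :
    |(∫ t in a..b, |Real.sin (N * t - θ)| / t) - 2 / π * Real.log (b / a)| ≤ π / (N * a) := by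
  have hcont : Continuous fun u : ℝ => |Real.sin u| - 2 / π := by fun_prop
  have hper : Function.Periodic (fun u : ℝ => |Real.sin u| - 2 / π) π := fun u => by
    simp [Real.sin_add_pi]
  have hbd : ∀ u : ℝ, |(|Real.sin u| - 2 / π)| ≤ 1 := fun u => by
    have h1 := Real.abs_sin_le_one u
    have h2 := abs_nonneg (Real.sin u)
    have h3 : 2 / π ≤ 1 := (div_le_one Real.pi_pos).2 Real.two_le_pi
    have h4 : 0 ≤ 2 / π := by positivity
    rw [abs_le]
    constructor <;> linarith
  have hzero : ∫ u in (0)..π, (|Real.sin u| - 2 / π) = 0 := by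
    rw [intervalIntegral.integral_sub ((by fun_prop : Continuous fun u : ℝ =>
      |Real.sin u|).intervalIntegrable _ _) (by simp)]
    have : ∫ u in (0)..π, |Real.sin u| = ∫ u in (0)..π, Real.sin u := by
      refine intervalIntegral.integral_congr fun u hu => ?_
      rw [Set.uIcc_of_le Real.pi_pos.le] at hu
      exact abs_of_nonneg (Real.sin_nonneg_of_mem_Icc hu)
    rw [this, integral_sin]
    simp
    field_simp
    norm_num
  have hB : ∀ x, |∫ t in a..x, (|Real.sin (N * t - θ)| - 2 / π)| ≤ π / N := fun x => by
    rw [intervalIntegral.integral_comp_mul_sub (fun u => |Real.sin u| - 2 / π) hN.ne' θ,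
      smul_eq_mul, abs_mul, abs_of_pos (inv_pos.2 hN)]
    have := abs_intervalIntegral_le_of_periodic Real.pi_pos hper
      (fun a b => hcont.intervalIntegrable a b) hbd hzero (N * a - θ) (N * x - θ)
    rw [one_mul] at this
    calc _ ≤ N⁻¹ * π := by gcongr
      _ = _ := by ring
  have h1 := abs_integral_div_le (by fun_prop) ha hab hB
  have h2 : ∫ t in a..b, (|Real.sin (N * t - θ)| - 2 / π) / t =
      (∫ t in a..b, |Real.sin (N * t - θ)| / t) - 2 / π * Real.log (b / a) := by
    simp_rw [sub_div]
    rw [intervalIntegral.integral_sub (intervalIntegrable_div_self (by fun_prop) ha hab)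
      (intervalIntegrable_div_self (by fun_prop) ha hab)]
    congr 1
    rw [← integral_one_div_of_pos ha (ha.trans_le hab), ← intervalIntegral.integral_const_mul]
    congr 1; ext t; ring
  rw [h2] at h1
  refine h1.trans (le_of_eq ?_)
  field_simp

/-- The sign of the sine function. -/
noncomputable def sinSign (u : ℝ) : ℝ := Real.sin u / |Real.sin u|

lemma measurable_sinSign : Measurable sinSign := by
  unfold sinSign; fun_prop

lemma abs_sinSign_le (u : ℝ) : |sinSign u| ≤ 1 := by
  unfold sinSign
  rw [abs_div, abs_abs]
  exact div_self_le_one _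

lemma sinSign_mul_sin (u : ℝ) : Real.sin u * sinSign u = |Real.sin u| := by
  unfold sinSign
  rcases eq_or_ne (Real.sin u) 0 with h | h
  -- At a zero of the sine the sign is `0/0 = 0`.
  · simp [h]
  · have := abs_ne_zero.2 h
    field_simp
    rw [sq_abs]

lemma intervalIntegrable_of_abs_le {g : ℝ → ℝ} (hg : Measurable g) {C : ℝ}
    (hC : ∀ x, |g x| ≤ C) (a b : ℝ) : IntervalIntegrable g volume a b := by
  refine (intervalIntegrable_const (c := C)).mono_fun hg.aestronglyMeasurable
    (ae_of_all _ fun x => ?_)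
  simpa using (hC x).trans (le_abs_self C)

/-- The sign changes under a shift by `π`, hence has mean zero over `2π`. -/
lemma abs_integral_sinSign_le {N : ℝ} (hN : 0 < N) (θ a b : ℝ) :
    |∫ t in a..b, sinSign (N * t - θ)| ≤ 2 * π / N := by
  have hint := intervalIntegrable_of_abs_le measurable_sinSign abs_sinSign_le
  have hanti : ∀ u, sinSign (u + π) = -sinSign u := fun u => by
    simp [sinSign, Real.sin_add_pi, neg_div]
  have hper : Function.Periodic sinSign (2 * π) := fun u => by
    rw [two_mul, ← add_assoc, hanti, hanti, neg_neg]
  have hzero : ∫ u in (0)..(2 * π), sinSign u = 0 := by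
    rw [← intervalIntegral.integral_add_adjacent_intervals (hint 0 π) (hint π (2 * π))]
    have := intervalIntegral.integral_comp_add_right (a := 0) (b := π) sinSign π
    rw [zero_add, ← two_mul] at this
    rw [← this]
    simp_rw [hanti]
    rw [intervalIntegral.integral_neg]
    ring
  rw [intervalIntegral.integral_comp_mul_sub sinSign hN.ne' θ, smul_eq_mul, abs_mul,
    abs_of_pos (inv_pos.2 hN)]
  have := abs_intervalIntegral_le_of_periodic Real.two_pi_pos hper hint abs_sinSign_le hzero
    (N * a - θ) (N * b - θ)
  rw [one_mul] at this
  calc _ ≤ N⁻¹ * (2 * π) := by gcongr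
    _ = _ := by ring

/-! ### Integrals over a half-period -/

lemma intervalIntegrable_sin_majorant {M N θ : ℝ} (hM : 1 ≤ M) (C : ℝ) :
    IntervalIntegrable (fun t => |Real.sin (N * t - θ)| / t) volume (1 / M) π ∧
      IntervalIntegrable (fun t : ℝ => C * (1 / t ^ 2) + 1) volume (1 / M) π := by
  have ha : 0 < 1 / M := by positivity
  have hab : 1 / M ≤ π := by
    have : 1 / M ≤ 1 := by rw [div_le_one (by linarith)]; exact hM
    linarith [Real.pi_gt_three]
  exact ⟨intervalIntegrable_div_self (by fun_prop) ha hab,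
    ((intervalIntegrable_one_div_sq ha hab).const_mul _).add (by simp)⟩

lemma abs_integral_sin_main_sub_le {M N : ℝ} (θ : ℝ) (hM : 1 ≤ M) (hN : 10 * M ≤ N) :
    |(∫ t in (1 / M)..π, |Real.sin (N * t - θ)| / t) - 2 / π * Real.log (π * M)| ≤ 1 := by
  have ha : 0 < 1 / M := by positivity
  have hab : 1 / M ≤ π := by
    have : 1 / M ≤ 1 := by rw [div_le_one (by linarith)]; exact hM
    linarith [Real.pi_gt_three]
  have hN0 : 0 < N := by linarith
  have h := abs_integral_abs_sin_div_sub_le θ (N := N) (by linarith) ha hab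
  have h1 : π / (1 / M) = π * M := by field_simp
  rw [h1] at h
  refine h.trans ?_
  -- The error is `πM/N ≤ π/10`.
  rw [div_le_one (by positivity), mul_one_div, le_div_iff₀ (by positivity)]
  nlinarith [Real.pi_lt_d2]

lemma integral_sin_error_le {M : ℝ} (hM : 1 ≤ M) :
    ∫ t in (1 / M)..π, (π ^ 2 / (2 * M) * (1 / t ^ 2) + 1) ≤ 9 := by
  have ha : 0 < 1 / M := by positivity
  have hab : 1 / M ≤ π := by
    have : 1 / M ≤ 1 := by rw [div_le_one (by linarith)]; exact hM
    linarith [Real.pi_gt_three]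
  rw [intervalIntegral.integral_add ((intervalIntegrable_one_div_sq ha hab).const_mul _) (by simp),
    intervalIntegral.integral_const_mul, integral_one_div_sq ha hab,
    intervalIntegral.integral_const]
  have hp := Real.pi_lt_d2
  have hp0 := Real.pi_pos
  have h1 : π ^ 2 / (2 * M) * (1 / (1 / M) - 1 / π) ≤ π ^ 2 / 2 := by
    have : π ^ 2 / (2 * M) * (1 / (1 / M) - 1 / π) = π ^ 2 / 2 - π / (2 * M) := by
      field_simp
    rw [this]
    have : 0 ≤ π / (2 * M) := by positivity
    linarith
  simp only [smul_eq_mul, mul_one]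
  nlinarith

section HalfPeriod

variable {K : ℝ → ℝ} {M N θ : ℝ}

/-- The constant is `13 = 3 + 1 + 9`: the interval `[0, 1/M]`, the oscillation error of the main
term, and the integrated pointwise error. -/
lemma integral_abs_le_of_near_sin (hK : Continuous K) (hM : 1 ≤ M) (hN : 10 * M ≤ N)
    (hKM : ∀ t, |K t| ≤ 1 + 2 * M)
    (hKs : ∀ t, 0 < t → t ≤ π →
      |K t + Real.sin (N * t - θ) / t| ≤ π ^ 2 / (2 * M) * (1 / t ^ 2) + 1) :
    ∫ t in (0)..π, |K t| ≤ 2 / π * Real.log (π * M) + 13 := by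
  have ha : 0 < 1 / M := by positivity
  have hab : 1 / M ≤ π := by
    have : 1 / M ≤ 1 := by rw [div_le_one (by linarith)]; exact hM
    linarith [Real.pi_gt_three]
  have hi := fun a b => hK.abs.intervalIntegrable (μ := volume) a b
  obtain ⟨hs, he⟩ := intervalIntegrable_sin_majorant (N := N) (θ := θ) hM (π ^ 2 / (2 * M))
  rw [← intervalIntegral.integral_add_adjacent_intervals (hi 0 (1 / M)) (hi (1 / M) π)]
  have h1 : ∫ t in (0)..(1 / M), |K t| ≤ 3 := by
    have := intervalIntegral.integral_mono_on ha.le (hi 0 (1 / M))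
      (intervalIntegrable_const (c := 1 + 2 * M)) fun t _ => hKM t
    refine this.trans ?_
    rw [intervalIntegral.integral_const, smul_eq_mul, sub_zero, one_div_mul_eq_div,
      div_le_iff₀ (by linarith)]
    linarith
  have h2 : ∫ t in (1 / M)..π, |K t| ≤
      ∫ t in (1 / M)..π, (|Real.sin (N * t - θ)| / t + (π ^ 2 / (2 * M) * (1 / t ^ 2) + 1)) := by
    refine intervalIntegral.integral_mono_on hab (hi _ _) (hs.add he) fun t ht => ?_
    have ht0 : 0 < t := ha.trans_le ht.1
    have h3 := hKs t ht0 ht.2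
    have h4 : |Real.sin (N * t - θ) / t| = |Real.sin (N * t - θ)| / t := by
      rw [abs_div, abs_of_pos ht0]
    have h5 := abs_sub (K t + Real.sin (N * t - θ) / t) (Real.sin (N * t - θ) / t)
    rw [add_sub_cancel_right, h4] at h5
    linarith
  rw [intervalIntegral.integral_add hs he] at h2
  have h3 := (abs_le.1 (abs_integral_sin_main_sub_le θ hM hN)).2
  have h4 := integral_sin_error_le hM
  linarith

lemma le_integral_mul_of_near_sin (hK : Continuous K) (hM : 1 ≤ M) (hN : 10 * M ≤ N)
    (hKM : ∀ t, |K t| ≤ 1 + 2 * M)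
    (hKs : ∀ t, 0 < t → t ≤ π →
      |K t + Real.sin (N * t - θ) / t| ≤ π ^ 2 / (2 * M) * (1 / t ^ 2) + 1)
    {φ : ℝ → ℝ} (hφ : Measurable φ) (hφ1 : ∀ t, |φ t| ≤ 1)
    (hφs : ∀ t, 1 / M ≤ t → t ≤ π → φ t = -sinSign (N * t - θ)) :
    2 / π * Real.log (π * M) - 13 ≤ ∫ t in (0)..π, K t * φ t := by
  have ha : 0 < 1 / M := by positivity
  have hab : 1 / M ≤ π := by
    have : 1 / M ≤ 1 := by rw [div_le_one (by linarith)]; exact hM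
    linarith [Real.pi_gt_three]
  have hb : ∀ t, |K t * φ t| ≤ 1 + 2 * M := fun t => by
    rw [abs_mul]
    calc |K t| * |φ t| ≤ |K t| * 1 := by gcongr; exact hφ1 t
      _ ≤ _ := by rw [mul_one]; exact hKM t
  have hi : ∀ a b, IntervalIntegrable (fun t => K t * φ t) volume a b :=
    intervalIntegrable_of_abs_le (hK.measurable.mul hφ) hb
  obtain ⟨hs, he⟩ := intervalIntegrable_sin_majorant (N := N) (θ := θ) hM (π ^ 2 / (2 * M))
  rw [← intervalIntegral.integral_add_adjacent_intervals (hi 0 (1 / M)) (hi (1 / M) π)]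
  have h1 : -3 ≤ ∫ t in (0)..(1 / M), K t * φ t := by
    have := intervalIntegral.integral_mono_on ha.le
      (intervalIntegrable_const (c := -(1 + 2 * M))) (hi 0 (1 / M))
      fun t _ => (abs_le.1 (hb t)).1
    refine le_trans ?_ this
    rw [intervalIntegral.integral_const, smul_eq_mul, sub_zero, one_div_mul_eq_div,
      le_div_iff₀ (by linarith)]
    linarith
  have h2 : ∫ t in (1 / M)..π,
      (|Real.sin (N * t - θ)| / t - (π ^ 2 / (2 * M) * (1 / t ^ 2) + 1)) ≤
      ∫ t in (1 / M)..π, K t * φ t := by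
    refine intervalIntegral.integral_mono_on hab (hs.sub he) (hi _ _) fun t ht => ?_
    have ht0 : 0 < t := ha.trans_le ht.1
    have h3 := hKs t ht0 ht.2
    have h4 : |(K t + Real.sin (N * t - θ) / t) * φ t| ≤
        π ^ 2 / (2 * M) * (1 / t ^ 2) + 1 := by
      rw [abs_mul]
      calc _ ≤ |K t + Real.sin (N * t - θ) / t| * 1 := by gcongr; exact hφ1 t
        _ ≤ _ := by rw [mul_one]; exact h3
    -- Against the sign `φ` the main term of `K` becomes `|sin|/t`.
    have h5 : K t * φ t = |Real.sin (N * t - θ)| / t +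
        (K t + Real.sin (N * t - θ) / t) * φ t := by
      rw [← sinSign_mul_sin, hφs t ht.1 ht.2]; ring
    rw [h5]
    linarith [(abs_le.1 h4).1]
  rw [intervalIntegral.integral_sub hs he] at h2
  have h3 := (abs_le.1 (abs_integral_sin_main_sub_le θ hM hN)).1
  have h4 := integral_sin_error_le hM
  linarith

end HalfPeriod

/-! ### Multiplier ratios: convexity and summation -/

/-- The ratios `ψ (n + j) / ψ n` of the multipliers `ψ k = exp (-α k ^ r)`. -/
noncomputable def ratio (α r : ℝ) (n j : ℕ) : ℝ :=
  Real.exp (-α * (((n : ℝ) + j) ^ r - (n : ℝ) ^ r))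

lemma ratio_nonneg (α r : ℝ) (n j : ℕ) : 0 ≤ ratio α r n j := (Real.exp_pos _).le

lemma ratio_zero (α r : ℝ) (n : ℕ) : ratio α r n 0 = 1 := by simp [ratio]

section Ratio

variable {α r : ℝ}

lemma ratio_succ_le (hα : 0 < α) (hr : 0 < r) (n j : ℕ) :
    ratio α r n (j + 1) ≤ ratio α r n j := by
  unfold ratio
  have h : ((n : ℝ) + j) ^ r ≤ ((n : ℝ) + (j + 1 : ℕ)) ^ r := by
    apply Real.rpow_le_rpow (by positivity) _ hr.le
    push_cast; linarith
  apply Real.exp_le_exp.2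
  nlinarith

/-- Concavity of `x^r` makes the exponent convex, and `exp` is increasing and convex; midpoint
convexity suffices. -/
lemma ratio_convex (hα : 0 < α) (hr : 0 < r) (hr1 : r < 1) (n j : ℕ) :
    ratio α r n (j + 1) - ratio α r n (j + 2) ≤ ratio α r n j - ratio α r n (j + 1) := by
  obtain ⟨-, hcc⟩ := Real.concaveOn_rpow hr.le hr1.le
  have hc := hcc (show (n : ℝ) + j ∈ Set.Ici 0 by simp only [Set.mem_Ici]; positivity)
    (show (n : ℝ) + (j + 2 : ℕ) ∈ Set.Ici 0 by simp only [Set.mem_Ici]; positivity)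
    (show (0 : ℝ) ≤ 1 / 2 by norm_num) (show (0 : ℝ) ≤ 1 / 2 by norm_num) (by norm_num)
  have hm : (1 / 2 : ℝ) • ((n : ℝ) + j) + (1 / 2 : ℝ) • ((n : ℝ) + (j + 2 : ℕ)) =
      (n : ℝ) + (j + 1 : ℕ) := by
    simp only [smul_eq_mul]; push_cast; ring
  rw [hm] at hc
  simp only [smul_eq_mul] at hc
  have he := convexOn_exp.2 (Set.mem_univ (-α * (((n : ℝ) + j) ^ r - (n : ℝ) ^ r)))
    (Set.mem_univ (-α * (((n : ℝ) + (j + 2 : ℕ)) ^ r - (n : ℝ) ^ r)))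
    (show (0 : ℝ) ≤ 1 / 2 by norm_num) (show (0 : ℝ) ≤ 1 / 2 by norm_num) (by norm_num)
  simp only [smul_eq_mul] at he
  have h1 : ratio α r n (j + 1) ≤ 1 / 2 * ratio α r n j + 1 / 2 * ratio α r n (j + 2) := by
    refine le_trans (Real.exp_le_exp.2 ?_) he
    nlinarith
  linarith

/-- From `1 - e^{-D} ≤ D` and Bernoulli's `(1 + 1/n)^r ≤ 1 + r/n`. -/
lemma ratio_zero_sub_one_le (hα : 0 < α) (hr : 0 < r) (hr1 : r < 1) {n : ℕ} (hn : 1 ≤ n) :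
    ratio α r n 0 - ratio α r n 1 ≤ 1 / ((n : ℝ) ^ (1 - r) / (α * r)) := by
  have hn0 : (0 : ℝ) < n := by exact_mod_cast hn
  have h1 : (1 + 1 / (n : ℝ)) ^ r ≤ 1 + r * (1 / n) :=
    rpow_one_add_le_one_add_mul_self (by have : 0 < 1 / (n : ℝ) := by positivity
                                         linarith) hr.le hr1.le
  have h2 : ((n : ℝ) + (1 : ℕ)) ^ r = (n : ℝ) ^ r * (1 + 1 / (n : ℝ)) ^ r := by
    rw [← Real.mul_rpow hn0.le (by positivity)]
    congr 1; push_cast; field_simp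
  have h3 : (n : ℝ) ^ (1 - r) = n / (n : ℝ) ^ r := by rw [Real.rpow_sub hn0, Real.rpow_one]
  have hnr : 0 < (n : ℝ) ^ r := by positivity
  have h4 := Real.add_one_le_exp (-α * (((n : ℝ) + (1 : ℕ)) ^ r - (n : ℝ) ^ r))
  rw [ratio_zero, h3]
  unfold ratio
  have h5 : α * (((n : ℝ) + (1 : ℕ)) ^ r - (n : ℝ) ^ r) ≤ α * ((n : ℝ) ^ r * (r * (1 / n))) := by
    rw [h2]
    gcongr
    nlinarith
  have h6 : 1 / (n / (n : ℝ) ^ r / (α * r)) = α * ((n : ℝ) ^ r * (r * (1 / n))) := by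
    field_simp
  rw [h6]
  rw [neg_mul] at h4 ⊢
  refine le_trans ?_ h5
  generalize α * (((n : ℝ) + (1 : ℕ)) ^ r - (n : ℝ) ^ r) = D at h4 ⊢
  linarith

/-- Since `(1 + j/n)^r ≥ 1 + r log(1 + j/n)`, the ratio is at most `(1 + j/n)^(-p)` with `p = αr
n^r`. Bernoulli with exponent `p/2 ≥ 1` then leaves a square, which is summable with sum of order
`M`. -/
lemma ratio_le (hα : 0 < α) (hr : 0 < r) {n : ℕ} (hn : 1 ≤ n)
    (hp : 2 ≤ α * r * (n : ℝ) ^ r) (j : ℕ) :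
    ratio α r n j ≤ (1 + j / (2 * ((n : ℝ) ^ (1 - r) / (α * r))))⁻¹ ^ 2 := by
  have hn0 : (0 : ℝ) < n := by exact_mod_cast hn
  have hnr : 0 < (n : ℝ) ^ r := by positivity
  have hx : 0 < 1 + (j : ℝ) / n := by positivity
  have h3 : (n : ℝ) ^ (1 - r) = n / (n : ℝ) ^ r := by rw [Real.rpow_sub hn0, Real.rpow_one]
  have h1 : 1 + (α * r * (n : ℝ) ^ r / 2) * (j / n) ≤ (1 + j / n) ^ (α * r * (n : ℝ) ^ r / 2) :=
    one_add_mul_self_le_rpow_one_add (by have : 0 ≤ (j : ℝ) / n := by positivity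
                                         linarith) (by linarith)
  have h2 : 1 + (j : ℝ) / (2 * ((n : ℝ) ^ (1 - r) / (α * r))) =
      1 + (α * r * (n : ℝ) ^ r / 2) * (j / n) := by
    rw [h3]; field_simp
  rw [h2]
  have h4 : ((n : ℝ) + j) ^ r = (n : ℝ) ^ r * (1 + j / n) ^ r := by
    rw [← Real.mul_rpow hn0.le hx.le]
    congr 1; field_simp
  have h5 : 1 + r * Real.log (1 + j / n) ≤ (1 + (j : ℝ) / n) ^ r := by
    rw [Real.rpow_def_of_pos hx, mul_comm r, add_comm]
    exact Real.add_one_le_exp _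
  have h6 : ratio α r n j ≤ ((1 + (j : ℝ) / n) ^ (α * r * (n : ℝ) ^ r / 2))⁻¹ ^ 2 := by
    rw [Real.rpow_def_of_pos hx, ← Real.exp_neg, ← Real.exp_nat_mul]
    unfold ratio
    apply Real.exp_le_exp.2
    rw [h4]
    have : α * (n : ℝ) ^ r * (r * Real.log (1 + j / n)) ≤
        α * (n : ℝ) ^ r * ((1 + (j : ℝ) / n) ^ r - 1) := by gcongr; linarith
    push_cast
    linarith
  refine h6.trans ?_
  gcongr

/-- The subtracted term makes the induction telescope. -/
lemma sum_range_inv_sq_le {M : ℝ} (hM : 0 < M) (m : ℕ) :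
    ∑ j ∈ Finset.range (m + 1), (1 + (j : ℝ) / (2 * M))⁻¹ ^ 2 ≤
      1 + 2 * M - 4 * M ^ 2 / (2 * M + m) := by
  induction m with
  | zero =>
    have : 4 * M ^ 2 / (2 * M) = 2 * M := by field_simp; norm_num
    simp [this]
  | succ m ih =>
    rw [Finset.sum_range_succ]
    have h : (1 + ((m + 1 : ℕ) : ℝ) / (2 * M))⁻¹ ^ 2 ≤
        4 * M ^ 2 / (2 * M + m) - 4 * M ^ 2 / (2 * M + (m + 1 : ℕ)) := by
      have hm : (0 : ℝ) ≤ m := by positivity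
      have e1 : (1 + ((m + 1 : ℕ) : ℝ) / (2 * M))⁻¹ ^ 2 = 4 * M ^ 2 / (2 * M + m + 1) ^ 2 := by
        push_cast
        field_simp
        ring
      have e2 : 4 * M ^ 2 / (2 * M + m) - 4 * M ^ 2 / (2 * M + (m + 1 : ℕ)) =
          4 * M ^ 2 / ((2 * M + m) * (2 * M + m + 1)) := by
        push_cast
        field_simp
        ring
      rw [e1, e2]
      gcongr
      nlinarith
    linarith

lemma sum_range_ratio_le (hα : 0 < α) (hr : 0 < r) {n : ℕ} (hn : 1 ≤ n)
    (hp : 2 ≤ α * r * (n : ℝ) ^ r) (m : ℕ) :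
    ∑ j ∈ Finset.range m, ratio α r n j ≤ 1 + 2 * ((n : ℝ) ^ (1 - r) / (α * r)) := by
  have hn0 : (0 : ℝ) < n := by exact_mod_cast hn
  have hM : 0 < (n : ℝ) ^ (1 - r) / (α * r) := by positivity
  have h1 : ∑ j ∈ Finset.range m, ratio α r n j ≤ ∑ j ∈ Finset.range (m + 1), ratio α r n j := by
    rw [Finset.sum_range_succ]
    linarith [ratio_nonneg α r n m]
  have h2 := Finset.sum_le_sum fun j (_ : j ∈ Finset.range (m + 1)) => ratio_le hα hr hn hp j
  have h3 := sum_range_inv_sq_le hM m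
  set M := (n : ℝ) ^ (1 - r) / (α * r)
  have h4 : 0 ≤ 4 * M ^ 2 / (2 * M + m) := by positivity
  linarith

lemma summable_ratio (hα : 0 < α) (hr : 0 < r) {n : ℕ} (hn : 1 ≤ n)
    (hp : 2 ≤ α * r * (n : ℝ) ^ r) : Summable (ratio α r n) :=
  summable_of_sum_range_le (ratio_nonneg α r n) (sum_range_ratio_le hα hr hn hp)

lemma tsum_ratio_le (hα : 0 < α) (hr : 0 < r) {n : ℕ} (hn : 1 ≤ n)
    (hp : 2 ≤ α * r * (n : ℝ) ^ r) :
    ∑' j, ratio α r n j ≤ 1 + 2 * ((n : ℝ) ^ (1 - r) / (α * r)) :=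
  Real.tsum_le_of_sum_range_le (ratio_nonneg α r n) (sum_range_ratio_le hα hr hn hp)

end Ratio

/-! ### Consequences of the threshold -/

/-- Beyond the threshold both parameters of the kernel are large. -/
lemma le_of_threshold_le {α r : ℝ} (hα : 0 < α) (hr : 0 < r) (hr1 : r < 1) {n : ℕ}
    (hn : threshold α r ≤ n) :
    1 ≤ n ∧ 100 ≤ α * r * (n : ℝ) ^ r ∧ 100 ≤ (n : ℝ) ^ (1 - r) / (α * r) := by
  obtain ⟨hm1, hm⟩ := (threshold_isLeast hα hr hr1).1
  set m := threshold α r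
  have hm0 : (0 : ℝ) < m := by exact_mod_cast hm1
  have hmn : (m : ℝ) ≤ n := by exact_mod_cast hn
  have hc : 0 < α * r := mul_pos hα hr
  have hpi := Real.pi_gt_three
  have hmr : 0 < (m : ℝ) ^ r := by positivity
  have hmr1 : 0 < (m : ℝ) ^ (1 - r) := by positivity
  set p := α * r * (m : ℝ) ^ r with hp
  set M := (m : ℝ) ^ (1 - r) / (α * r) with hMdef
  have hp0 : 0 < p := by positivity
  have hM0 : 0 < M := by positivity
  have hpM : p * M = m := by
    rw [hp, hMdef]
    have : (m : ℝ) ^ r * (m : ℝ) ^ (1 - r) = m := by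
      rw [← Real.rpow_add hm0]; simp
    field_simp
    linarith
  have e1 : 1 / (α * r) * (1 / (m : ℝ) ^ r) = 1 / p := by rw [hp]; field_simp
  have e2 : π * (m : ℝ) ^ (1 - r) / (α * r) = π * M := by rw [hMdef]; ring
  have e3 : α * r / (m : ℝ) ^ (1 - r) = 1 / M := by rw [hMdef]; field_simp
  rw [e1, e2, e3] at hm
  have hε : 1 / (3 * π) ^ 3 ≤ 1 / 100 := by
    apply one_div_le_one_div_of_le (by norm_num)
    have : (9 : ℝ) ^ 3 ≤ (3 * π) ^ 3 := by gcongr; linarith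
    linarith
  have hp1 : 0 < 1 / p := by positivity
  have hM1 : 0 < 1 / M := by positivity
  have hprod : (1 / p) * (1 / M) ≤ 1 := by
    rw [one_div_mul_one_div, hpM, div_le_one hm0]
    exact_mod_cast hm1
  have hlog := Real.one_sub_inv_le_log_of_pos (x := π * M) (by positivity)
  have hinv : (π * M)⁻¹ ≤ 1 / 3 * (1 / M) := by
    rw [mul_inv, ← one_div, ← one_div]
    gcongr
  -- The logarithm could a priori be negative. The bound `log x ≥ 1 - 1/x` together with `1/(pM) =
  -- 1/m ≤ 1` first excludes small `M`; afterwards both terms of the condition are nonnegative and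
  -- can be bounded separately.
  have hMle : 1 / M ≤ 1 := by
    have h1 : (1 / p) * (2 - 1 / 3 * (1 / M)) ≤ (1 / p) * (1 + Real.log (π * M)) := by
      gcongr; linarith
    nlinarith
  have hlog0 : 0 ≤ Real.log (π * M) := by linarith
  have h2 : 1 / p ≤ (1 / p) * (1 + Real.log (π * M)) := by nlinarith
  have hp100 : 100 ≤ p := by
    have : 1 / p ≤ 1 / 100 := by linarith
    exact (one_div_le_one_div hp0 (by norm_num)).1 this
  have hM100 : 100 ≤ M := by
    have : 1 / M ≤ 1 / 100 := by linarith
    exact (one_div_le_one_div hM0 (by norm_num)).1 this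
  -- Both parameters increase with the integer, so the bounds pass from `m` to `n`.
  refine ⟨hm1.trans hn, hp100.trans ?_, hM100.trans ?_⟩
  · rw [hp]; gcongr
  · rw [hMdef]
    have := sub_pos.2 hr1
    gcongr

/-! ### Fourier coefficients of absolutely convergent trigonometric series -/

section Orthogonality

lemma integral_cos_int_mul {j : ℤ} (hj : j ≠ 0) : ∫ t in (-π)..π, Real.cos (j * t) = 0 := by
  have hj' : (j : ℝ) ≠ 0 := by exact_mod_cast hj
  rw [intervalIntegral.integral_comp_mul_left _ hj', integral_cos]
  simp [Real.sin_int_mul_pi]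

lemma integral_sin_mul (u : ℝ) : ∫ t in (-π)..π, Real.sin (u * t) = 0 := by
  rcases eq_or_ne u 0 with rfl | hu
  · simp
  · rw [intervalIntegral.integral_comp_mul_left _ hu, integral_sin]
    simp

lemma integral_cos_mul_cos (k m : ℕ) : ∫ t in (-π)..π,
    Real.cos (((k : ℝ) + 1) * t) * Real.cos (m * t) = if k + 1 = m then π else 0 := by
  have h : ∀ t : ℝ, Real.cos (((k : ℝ) + 1) * t) * Real.cos (m * t) =
      1 / 2 * Real.cos (((k + 1 - m : ℤ) : ℝ) * t) +
        1 / 2 * Real.cos (((k + 1 + m : ℤ) : ℝ) * t) := fun t => by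
    push_cast
    rw [sub_mul, add_mul _ (m : ℝ), Real.cos_sub, Real.cos_add]; ring
  simp_rw [h]
  rw [intervalIntegral.integral_add (Continuous.intervalIntegrable (by fun_prop) _ _)
    (Continuous.intervalIntegrable (by fun_prop) _ _), intervalIntegral.integral_const_mul,
    intervalIntegral.integral_const_mul, integral_cos_int_mul (j := k + 1 + m) (by omega)]
  split_ifs with hk
  · have : (k + 1 - m : ℤ) = 0 := by omega
    rw [this]
    simp
    ring
  · rw [integral_cos_int_mul (by omega)]
    simp

lemma integral_sin_mul_sin (k m : ℕ) : ∫ t in (-π)..π,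
    Real.sin (((k : ℝ) + 1) * t) * Real.sin (m * t) = if k + 1 = m then π else 0 := by
  have h : ∀ t : ℝ, Real.sin (((k : ℝ) + 1) * t) * Real.sin (m * t) =
      1 / 2 * Real.cos (((k + 1 - m : ℤ) : ℝ) * t) -
        1 / 2 * Real.cos (((k + 1 + m : ℤ) : ℝ) * t) := fun t => by
    push_cast
    rw [sub_mul, add_mul _ (m : ℝ), Real.cos_sub, Real.cos_add]; ring
  simp_rw [h]
  rw [intervalIntegral.integral_sub (Continuous.intervalIntegrable (by fun_prop) _ _)
    (Continuous.intervalIntegrable (by fun_prop) _ _), intervalIntegral.integral_const_mul,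
    intervalIntegral.integral_const_mul, integral_cos_int_mul (j := k + 1 + m) (by omega)]
  split_ifs with hk
  · have : (k + 1 - m : ℤ) = 0 := by omega
    rw [this]
    simp
    ring
  · rw [integral_cos_int_mul (by omega)]
    simp

lemma integral_sin_mul_cos (u v : ℝ) :
    ∫ t in (-π)..π, Real.sin (u * t) * Real.cos (v * t) = 0 := by
  have h : ∀ t : ℝ, Real.sin (u * t) * Real.cos (v * t) =
      1 / 2 * Real.sin ((u + v) * t) + 1 / 2 * Real.sin ((u - v) * t) := fun t => by
    rw [sub_mul, add_mul, Real.sin_sub, Real.sin_add]; ring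
  simp_rw [h]
  rw [intervalIntegral.integral_add (Continuous.intervalIntegrable (by fun_prop) _ _)
    (Continuous.intervalIntegrable (by fun_prop) _ _), intervalIntegral.integral_const_mul,
    intervalIntegral.integral_const_mul, integral_sin_mul, integral_sin_mul]
  simp

lemma integral_cos_mul_sin (u v : ℝ) :
    ∫ t in (-π)..π, Real.cos (u * t) * Real.sin (v * t) = 0 := by
  rw [← integral_sin_mul_cos v u]
  congr 1; ext t; ring

end Orthogonality

/-- Termwise integration of a normally convergent series against an integrable function. -/
lemma hasSum_integral_tsum_mul {w : ℕ → ℝ} (hw : Summable w) {g : ℕ → ℝ → ℝ}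
    (hg : ∀ k, Continuous (g k)) (hgw : ∀ k t, |g k t| ≤ w k) {φ : ℝ → ℝ} {a b : ℝ}
    (hφ : IntervalIntegrable φ volume a b) :
    HasSum (fun k => ∫ t in a..b, g k t * φ t) (∫ t in a..b, (∑' k, g k t) * φ t) := by
  refine intervalIntegral.hasSum_integral_of_dominated_convergence (fun k t => w k * |φ t|)
    (fun k => (hg k).aestronglyMeasurable.mul (intervalIntegrable_iff.1 hφ).aestronglyMeasurable)
    (fun k => ae_of_all _ fun t _ => ?_) (ae_of_all _ fun t _ => hw.mul_right _) ?_
    (ae_of_all _ fun t _ => ?_)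
  · rw [norm_mul, Real.norm_eq_abs, Real.norm_eq_abs]
    exact mul_le_mul_of_nonneg_right (hgw k t) (abs_nonneg _)
  · simp_rw [tsum_mul_right]
    exact hφ.abs.const_mul _
  · have h : Summable fun k => g k t := Summable.of_norm_bounded hw fun k => hgw k t
    exact h.hasSum.mul_right (φ t)

/-- The trigonometric series `a₀ / 2 + ∑ (p k cos (k + 1) x + q k sin (k + 1) x)`. -/
noncomputable def trigSeries (a₀ : ℝ) (p q : ℕ → ℝ) (x : ℝ) : ℝ :=
  a₀ / 2 + ∑' k : ℕ, (p k * Real.cos (((k : ℝ) + 1) * x) + q k * Real.sin (((k : ℝ) + 1) * x))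

section TrigSeries

variable {a₀ : ℝ} {p q w : ℕ → ℝ}

lemma abs_trig_term_le (hpw : ∀ k, |p k| ≤ w k) (hqw : ∀ k, |q k| ≤ w k)
    (k : ℕ) (x : ℝ) :
    |p k * Real.cos (((k : ℝ) + 1) * x) + q k * Real.sin (((k : ℝ) + 1) * x)| ≤ 2 * w k := by
  refine (abs_add_le _ _).trans ?_
  rw [abs_mul, abs_mul, two_mul]
  gcongr
  · exact (mul_le_of_le_one_right (abs_nonneg _) (Real.abs_cos_le_one _)).trans (hpw k)
  · exact (mul_le_of_le_one_right (abs_nonneg _) (Real.abs_sin_le_one _)).trans (hqw k)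

lemma hasSum_integral_trigSeries_mul (hw : Summable w) (hpw : ∀ k, |p k| ≤ w k)
    (hqw : ∀ k, |q k| ≤ w k) {φ : ℝ → ℝ} (hφ : Continuous φ) :
    HasSum (fun k : ℕ => p k * (∫ t in (-π)..π, Real.cos (((k : ℝ) + 1) * t) * φ t) +
        q k * ∫ t in (-π)..π, Real.sin (((k : ℝ) + 1) * t) * φ t)
      ((∫ t in (-π)..π, trigSeries a₀ p q t * φ t) - a₀ / 2 * ∫ t in (-π)..π, φ t) := by
  have hw2 : Summable fun k => 2 * w k := hw.mul_left 2
  have h := hasSum_integral_tsum_mul hw2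
    (g := fun k x => p k * Real.cos (((k : ℝ) + 1) * x) + q k * Real.sin (((k : ℝ) + 1) * x))
    (fun k => by fun_prop) (abs_trig_term_le hpw hqw) (hφ.intervalIntegrable (-π) π)
  have hcont : Continuous fun x : ℝ => ∑' k : ℕ,
      (p k * Real.cos (((k : ℝ) + 1) * x) + q k * Real.sin (((k : ℝ) + 1) * x)) :=
    continuous_tsum (fun k => by fun_prop) hw2 (abs_trig_term_le hpw hqw)
  convert h using 1
  · ext k
    rw [← intervalIntegral.integral_const_mul, ← intervalIntegral.integral_const_mul,
      ← intervalIntegral.integral_add (Continuous.intervalIntegrable (by fun_prop) _ _)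
        (Continuous.intervalIntegrable (by fun_prop) _ _)]
    congr 1; ext t; ring
  · rw [← intervalIntegral.integral_const_mul, ← intervalIntegral.integral_sub]
    · congr 1; ext t
      unfold trigSeries; ring
    · exact ((continuous_const.add hcont).mul hφ).intervalIntegrable _ _
    · exact (hφ.const_mul _).intervalIntegrable _ _

lemma hasSum_mul_ite_pi (p : ℕ → ℝ) (m : ℕ) :
    HasSum (fun k => p k * if k = m then π else 0) (p m * π) := by
  have h := hasSum_single (f := fun k => p k * if k = m then π else 0) m fun k hk => by simp [hk]
  simpa using h

lemma cosCoeff_trigSeries_zero (hw : Summable w) (hpw : ∀ k, |p k| ≤ w k)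
    (hqw : ∀ k, |q k| ≤ w k) : cosCoeff (trigSeries a₀ p q) 0 = a₀ := by
  have h := hasSum_integral_trigSeries_mul (a₀ := a₀) hw hpw hqw
    (φ := fun t => Real.cos ((0 : ℕ) * t)) (by fun_prop)
  simp_rw [integral_cos_mul_cos, integral_sin_mul_cos] at h
  simp only [Nat.add_eq_zero_iff, one_ne_zero, and_false, if_false, mul_zero, add_zero] at h
  have h2 := h.unique hasSum_zero
  have h3 : ∫ t in (-π)..π, Real.cos ((0 : ℕ) * t) = 2 * π := by simp; ring
  rw [h3] at h2
  unfold cosCoeff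
  rw [sub_eq_zero.1 h2]
  field_simp

lemma cosCoeff_trigSeries_succ (hw : Summable w) (hpw : ∀ k, |p k| ≤ w k)
    (hqw : ∀ k, |q k| ≤ w k) (m : ℕ) : cosCoeff (trigSeries a₀ p q) (m + 1) = p m := by
  have h := hasSum_integral_trigSeries_mul (a₀ := a₀) hw hpw hqw
    (φ := fun t => Real.cos ((m + 1 : ℕ) * t)) (by fun_prop)
  simp_rw [integral_cos_mul_cos, integral_sin_mul_cos] at h
  simp only [Nat.add_right_cancel_iff, mul_zero, add_zero] at h
  have h2 := h.unique (hasSum_mul_ite_pi p m)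
  have h3 : ∫ t in (-π)..π, Real.cos ((m + 1 : ℕ) * t) = 0 :=
    integral_cos_int_mul (j := (m + 1 : ℕ)) (by omega)
  rw [h3, mul_zero, sub_zero] at h2
  unfold cosCoeff
  rw [h2]
  field_simp

lemma sinCoeff_trigSeries_succ (hw : Summable w) (hpw : ∀ k, |p k| ≤ w k)
    (hqw : ∀ k, |q k| ≤ w k) (m : ℕ) : sinCoeff (trigSeries a₀ p q) (m + 1) = q m := by
  have h := hasSum_integral_trigSeries_mul (a₀ := a₀) hw hpw hqw
    (φ := fun t => Real.sin ((m + 1 : ℕ) * t)) (by fun_prop)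
  simp_rw [integral_sin_mul_sin, integral_cos_mul_sin] at h
  simp only [Nat.add_right_cancel_iff, mul_zero, zero_add] at h
  have h2 := h.unique (hasSum_mul_ite_pi q m)
  rw [integral_sin_mul, mul_zero, sub_zero] at h2
  unfold sinCoeff
  rw [h2]
  field_simp

lemma trigSeries_sub_fourierSum (hw : Summable w) (hpw : ∀ k, |p k| ≤ w k)
    (hqw : ∀ k, |q k| ≤ w k) (m : ℕ) (x : ℝ) :
    trigSeries a₀ p q x - fourierSum m (trigSeries a₀ p q) x =
      ∑' k : ℕ, (p (k + m) * Real.cos (((k + m : ℕ) + 1 : ℝ) * x) +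
        q (k + m) * Real.sin (((k + m : ℕ) + 1 : ℝ) * x)) := by
  have hs : Summable fun k : ℕ =>
      p k * Real.cos (((k : ℝ) + 1) * x) + q k * Real.sin (((k : ℝ) + 1) * x) :=
    Summable.of_norm_bounded (hw.mul_left 2) fun k => abs_trig_term_le hpw hqw k x
  -- Index `k` carries frequency `k + 1`, so the sum of order `m` removes exactly the terms `k < m`.
  have hsum : fourierSum m (trigSeries a₀ p q) x = a₀ / 2 + ∑ k ∈ Finset.range m,
      (p k * Real.cos (((k : ℝ) + 1) * x) + q k * Real.sin (((k : ℝ) + 1) * x)) := by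
    unfold fourierSum
    rw [cosCoeff_trigSeries_zero hw hpw hqw]
    congr 1
    induction m with
    | zero => simp
    | succ m ih =>
      rw [Finset.sum_Icc_succ_top (by omega), ih, Finset.sum_range_succ,
        cosCoeff_trigSeries_succ hw hpw hqw, sinCoeff_trigSeries_succ hw hpw hqw]
      push_cast
      rfl
  rw [hsum]
  have := hs.sum_add_tsum_nat_add m
  unfold trigSeries
  rw [← this]
  ring

end TrigSeries

/-! ### The remainder as a convolution -/

section Convolution

variable {φ : ℝ → ℝ}

lemma intervalIntegrable_cos_mul (hφ : IntervalIntegrable φ volume (-π) π) (u v : ℝ) :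
    IntervalIntegrable (fun t => Real.cos (u * t + v) * φ t) volume (-π) π :=
  hφ.continuousOn_mul (by fun_prop)

lemma intervalIntegrable_sin_mul (hφ : IntervalIntegrable φ volume (-π) π) (u v : ℝ) :
    IntervalIntegrable (fun t => Real.sin (u * t + v) * φ t) volume (-π) π :=
  hφ.continuousOn_mul (by fun_prop)

lemma integral_cos_sub_mul (hφ : IntervalIntegrable φ volume (-π) π) (u θ x : ℝ) :
    ∫ t in (-π)..π, Real.cos (u * (x - t) - θ) * φ t =
      (∫ t in (-π)..π, Real.cos (u * t + θ) * φ t) * Real.cos (u * x) +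
        (∫ t in (-π)..π, Real.sin (u * t + θ) * φ t) * Real.sin (u * x) := by
  rw [← intervalIntegral.integral_mul_const, ← intervalIntegral.integral_mul_const,
    ← intervalIntegral.integral_add ((intervalIntegrable_cos_mul hφ u θ).mul_const _)
      ((intervalIntegrable_sin_mul hφ u θ).mul_const _)]
  congr 1; ext t
  have : u * (x - t) - θ = u * x - (u * t + θ) := by ring
  rw [this, Real.cos_sub]
  ring

lemma abs_integral_mul_le (hφ : IntervalIntegrable φ volume (-π) π) {g : ℝ → ℝ}
    (hg : ∀ t, |g t| ≤ 1) : |∫ t in (-π)..π, g t * φ t| ≤ ∫ t in (-π)..π, |φ t| := by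
  have hπ : -π ≤ π := by linarith [Real.pi_pos]
  rw [← Real.norm_eq_abs]
  refine intervalIntegral.norm_integral_le_of_norm_le hπ (ae_of_all _ fun t _ => ?_) hφ.abs
  rw [norm_mul, Real.norm_eq_abs, Real.norm_eq_abs]
  exact mul_le_of_le_one_left (abs_nonneg _) (hg t)

lemma integral_tsum_mul_cos_mul {w : ℕ → ℝ} (hw : Summable w) (hw0 : ∀ k, 0 ≤ w k)
    (hφ : IntervalIntegrable φ volume (-π) π) (u : ℕ → ℝ) (θ x : ℝ) :
    ∫ t in (-π)..π, (∑' k, w k * Real.cos (u k * (x - t) - θ)) * φ t =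
      ∑' k, w k * ∫ t in (-π)..π, Real.cos (u k * (x - t) - θ) * φ t := by
  have h := hasSum_integral_tsum_mul hw
    (g := fun k t => w k * Real.cos (u k * (x - t) - θ)) (fun k => by fun_prop)
    (fun k t => by
      rw [abs_mul, abs_of_nonneg (hw0 k)]
      exact mul_le_of_le_one_right (hw0 k) (Real.abs_cos_le_one _)) hφ
  rw [← h.tsum_eq]
  congr 1; ext k
  rw [← intervalIntegral.integral_const_mul]
  congr 1; ext t; ring

end Convolution

lemma exp_rpow_eq_ratio (α r : ℝ) {n : ℕ} (hn : 1 ≤ n) (j : ℕ) :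
    Real.exp (-α * (((j + (n - 1) : ℕ) : ℝ) + 1) ^ r) =
      Real.exp (-α * (n : ℝ) ^ r) * ratio α r n j := by
  unfold ratio
  rw [← Real.exp_add]
  have : ((j + (n - 1) : ℕ) : ℝ) + 1 = n + j := by
    rw [← Nat.cast_add_one, show j + (n - 1) + 1 = n + j by omega]
    push_cast; ring
  rw [this]
  congr 1; ring

/-- The Fourier remainder of a generalized Poisson integral is a convolution with the tail of
the kernel. -/
lemma sub_fourierSum_eq {α r β : ℝ} {n : ℕ} (hn : 1 ≤ n) (hs : Summable (ratio α r n))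
    {φ : ℝ → ℝ} (hφ : IntervalIntegrable φ volume (-π) π) {f : ℝ → ℝ} {a₀ : ℝ}
    (hf : ∀ x, f x = a₀ / 2 + 1 / π * ∫ t in (-π)..π, poissonKernel α r β (x - t) * φ t)
    (x : ℝ) :
    f x - fourierSum (n - 1) f x = Real.exp (-α * (n : ℝ) ^ r) *
      (1 / π * ∫ t in (-π)..π, tailKernel (ratio α r n) n (β * π / 2) (x - t) * φ t) := by
  set θ := β * π / 2 with hθ
  set w : ℕ → ℝ := fun k => Real.exp (-α * ((k : ℝ) + 1) ^ r) with hwdef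
  have hw0 : ∀ k, 0 ≤ w k := fun k => (Real.exp_pos _).le
  have hw : Summable w := by
    refine (summable_nat_add_iff (n - 1)).1 ?_
    refine (hs.mul_left (Real.exp (-α * (n : ℝ) ^ r))).congr fun j => ?_
    exact (exp_rpow_eq_ratio α r hn j).symm
  set A : ℕ → ℝ := fun k => ∫ t in (-π)..π, Real.cos (((k : ℝ) + 1) * t + θ) * φ t with hA
  set B : ℕ → ℝ := fun k => ∫ t in (-π)..π, Real.sin (((k : ℝ) + 1) * t + θ) * φ t with hB
  set I := ∫ t in (-π)..π, |φ t| with hI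
  -- Expanding the shifted cosine makes `f` a trigonometric series with summable coefficients, whose
  -- Fourier sums are its truncations.
  have hfs : f = trigSeries a₀ (fun k => 1 / π * (w k * A k)) (fun k => 1 / π * (w k * B k)) := by
    ext y
    rw [hf y]
    unfold trigSeries poissonKernel
    rw [integral_tsum_mul_cos_mul hw hw0 hφ (fun k => (k : ℝ) + 1) θ y, ← tsum_mul_left]
    congr 2; ext k
    rw [integral_cos_sub_mul hφ]
    ring
  have hWs : Summable fun k => 1 / π * (w k * I) := (hw.mul_right I).mul_left _
  have hbound : ∀ k (C : ℝ), |C| ≤ I → |1 / π * (w k * C)| ≤ 1 / π * (w k * I) := fun k C hC => by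
    have hpi := Real.pi_pos
    rw [abs_mul, abs_mul, abs_of_nonneg (hw0 k), abs_of_pos (by positivity : 0 < 1 / π)]
    exact mul_le_mul_of_nonneg_left (mul_le_mul_of_nonneg_left hC (hw0 k)) (by positivity)
  have hmain := trigSeries_sub_fourierSum (a₀ := a₀) hWs
    (fun k => hbound k (A k) (abs_integral_mul_le hφ fun t => Real.abs_cos_le_one _))
    (fun k => hbound k (B k) (abs_integral_mul_le hφ fun t => Real.abs_sin_le_one _)) (n - 1) x
  rw [← hfs] at hmain
  rw [hmain]
  unfold tailKernel
  rw [integral_tsum_mul_cos_mul hs (ratio_nonneg α r n) hφ (fun j => (n : ℝ) + j) θ x,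
    ← mul_assoc, ← tsum_mul_left]
  congr 1; ext j
  have hnj : (((j + (n - 1) : ℕ) : ℝ) + 1) = (n : ℝ) + j := by
    rw [← Nat.cast_add_one, show j + (n - 1) + 1 = n + j by omega]
    push_cast; ring
  have hwj : w (j + (n - 1)) = Real.exp (-α * (n : ℝ) ^ r) * ratio α r n j :=
    exp_rpow_eq_ratio α r hn j
  rw [integral_cos_sub_mul hφ, hwj]
  simp only [hA, hB, hnj]
  ring

lemma zeroMeanBall_top {φ : ℝ → ℝ} (hφ : φ ∈ zeroMeanBall ⊤) :
    IntervalIntegrable φ volume (-π) π ∧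
      ∀ᵐ t ∂volume.restrict (Set.Ioc (-π) π), |φ t| ≤ 1 := by
  obtain ⟨-, hm, hb, -⟩ := hφ
  have hπ : -π ≤ π := by linarith [Real.pi_pos]
  constructor
  · rw [intervalIntegrable_iff_integrableOn_Ioc_of_le hπ]
    exact MemLp.integrable le_top ⟨hm, hb.trans_lt ENNReal.one_lt_top⟩
  · rw [eLpNorm_exponent_top] at hb
    filter_upwards [ae_le_eLpNormEssSup (f := φ) (μ := volume.restrict (Set.Ioc (-π) π))] with t ht
    have := ht.trans hb
    rw [Real.enorm_eq_ofReal_abs] at this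
    simpa using ENNReal.ofReal_le_one.1 this

lemma integral_neg_pi_pi_eq {g : ℝ → ℝ} (hg : IntervalIntegrable g volume (-π) π) :
    ∫ t in (-π)..π, g t = (∫ t in (0)..π, g t) + ∫ t in (0)..π, g (-t) := by
  have hpi := Real.pi_pos
  have h1 : IntervalIntegrable g volume (-π) 0 := hg.mono_set (by
    rw [Set.uIcc_of_le (by linarith), Set.uIcc_of_le (by linarith)]
    exact Set.Icc_subset_Icc_right hpi.le)
  have h2 : IntervalIntegrable g volume 0 π := hg.mono_set (by
    rw [Set.uIcc_of_le (by linarith), Set.uIcc_of_le (by linarith)]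
    exact Set.Icc_subset_Icc_left (by linarith))
  rw [← intervalIntegral.integral_add_adjacent_intervals h1 h2, add_comm,
    intervalIntegral.integral_comp_neg, neg_zero]

/-! ### The extremal function -/

/-- A sign function of a sine on `[δ, ∞)`, extended by the constant `κ`. -/
noncomputable def cutSign (N θ δ κ t : ℝ) : ℝ := if δ ≤ t then -sinSign (N * t - θ) else κ

lemma measurable_cutSign (N θ δ κ : ℝ) : Measurable (cutSign N θ δ κ) := by
  unfold cutSign
  exact Measurable.ite measurableSet_Ici
    (measurable_sinSign.comp (by fun_prop)).neg measurable_const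

lemma abs_cutSign_le {κ : ℝ} (hκ : |κ| ≤ 1) (N θ δ t : ℝ) : |cutSign N θ δ κ t| ≤ 1 := by
  unfold cutSign
  split_ifs
  · rw [abs_neg]; exact abs_sinSign_le _
  · exact hκ

lemma integral_cutSign {N θ δ κ : ℝ} (hκ : |κ| ≤ 1) (hδ : 0 < δ) (hδπ : δ ≤ π) :
    ∫ t in (0)..π, cutSign N θ δ κ t = δ * κ - ∫ t in δ..π, sinSign (N * t - θ) := by
  have hi := intervalIntegrable_of_abs_le (measurable_cutSign N θ δ κ) (abs_cutSign_le hκ N θ δ)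
  have h1 : ∫ t in (0)..δ, cutSign N θ δ κ t = ∫ _ in (0)..δ, κ :=
    intervalIntegral.integral_congr_Ioo_of_le hδ.le fun t ht => if_neg ht.2.not_ge
  have h2 : ∫ t in δ..π, cutSign N θ δ κ t = ∫ t in δ..π, -sinSign (N * t - θ) :=
    intervalIntegral.integral_congr_Ioo_of_le hδπ fun t ht => if_pos ht.1.le
  rw [← intervalIntegral.integral_add_adjacent_intervals (hi 0 δ) (hi δ π), h1, h2,
    intervalIntegral.integral_neg, intervalIntegral.integral_const, smul_eq_mul, sub_zero,
    sub_eq_add_neg]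

/-- An extremal function for the kernel: a sign of a sine away from zero, and constant near
zero. -/
noncomputable def extremalSign (N θ δ κ t : ℝ) : ℝ :=
  if 0 ≤ t then cutSign N (-θ) δ κ t else cutSign N θ δ κ (-t)

section Extremal

variable {N θ δ κ : ℝ}

lemma measurable_extremalSign (N θ δ κ : ℝ) : Measurable (extremalSign N θ δ κ) := by
  unfold extremalSign
  exact Measurable.ite measurableSet_Ici (measurable_cutSign _ _ _ _)
    ((measurable_cutSign _ _ _ _).comp measurable_neg)

lemma abs_extremalSign_le (hκ : |κ| ≤ 1) (N θ δ t : ℝ) : |extremalSign N θ δ κ t| ≤ 1 := by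
  unfold extremalSign
  split_ifs
  · exact abs_cutSign_le hκ _ _ _ _
  · exact abs_cutSign_le hκ _ _ _ _

lemma extremalSign_of_nonneg {t : ℝ} (ht : 0 ≤ t) :
    extremalSign N θ δ κ t = cutSign N (-θ) δ κ t := if_pos ht

lemma extremalSign_neg (hδ : 0 < δ) {t : ℝ} (ht : 0 ≤ t) :
    extremalSign N θ δ κ (-t) = cutSign N θ δ κ t := by
  unfold extremalSign
  rcases ht.eq_or_lt with rfl | h
  -- At `t = 0` the two branches agree: both equal `κ` because `δ > 0`.
  · simp [cutSign, hδ.not_ge]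
  · rw [if_neg (by linarith), neg_neg]

lemma integral_extremalSign (hκ : |κ| ≤ 1) (hδ : 0 < δ) (hδπ : δ ≤ π) :
    ∫ t in (-π)..π, extremalSign N θ δ κ t = 2 * δ * κ -
      ((∫ t in δ..π, sinSign (N * t - -θ)) + ∫ t in δ..π, sinSign (N * t - θ)) := by
  have hi := intervalIntegrable_of_abs_le (measurable_extremalSign N θ δ κ)
    (abs_extremalSign_le hκ N θ δ)
  have hpi := Real.pi_pos.le
  have h1 : ∫ t in (0)..π, extremalSign N θ δ κ t = ∫ t in (0)..π, cutSign N (-θ) δ κ t :=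
    intervalIntegral.integral_congr fun t ht => by
      rw [Set.uIcc_of_le hpi] at ht
      exact extremalSign_of_nonneg ht.1
  have h2 : ∫ t in (0)..π, extremalSign N θ δ κ (-t) = ∫ t in (0)..π, cutSign N θ δ κ t :=
    intervalIntegral.integral_congr fun t ht => by
      rw [Set.uIcc_of_le hpi] at ht
      exact extremalSign_neg hδ ht.1
  rw [integral_neg_pi_pi_eq (hi _ _), h1, h2, integral_cutSign hκ hδ hδπ,
    integral_cutSign hκ hδ hδπ]
  ring

/-- For high frequency there is an extremal function with mean value zero. -/
lemma exists_integral_extremalSign_eq_zero (θ : ℝ) (hδ : 0 < δ) (hδπ : δ ≤ π)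
    (hN : 10 ≤ N * δ) :
    ∃ κ : ℝ, |κ| ≤ 1 ∧ ∫ t in (-π)..π, extremalSign N θ δ κ t = 0 := by
  have hN0 : 0 < N := pos_of_mul_pos_left (by linarith) hδ.le
  set A := ∫ t in δ..π, sinSign (N * t - -θ)
  set B := ∫ t in δ..π, sinSign (N * t - θ)
  have hA : |A| ≤ 2 * π / N := abs_integral_sinSign_le hN0 (-θ) δ π
  have hB : |B| ≤ 2 * π / N := abs_integral_sinSign_le hN0 θ δ π
  -- This `κ` solves `2δκ = A + B`; it is admissible because `2π < 10 ≤ Nδ`.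
  have hκ : |(A + B) / (2 * δ)| ≤ 1 := by
    have h2 : 2 * π / N ≤ δ := by
      rw [div_le_iff₀ hN0]
      linarith [Real.pi_lt_d2]
    rw [abs_div, abs_of_pos (by positivity : 0 < 2 * δ), div_le_one (by positivity)]
    linarith [abs_add_le A B]
  refine ⟨_, hκ, ?_⟩
  rw [integral_extremalSign hκ hδ hδπ]
  field_simp
  ring

end Extremal

/-- The `2π`-periodic extension of the restriction of a function to `(-π, π]`. -/
noncomputable def periodize (φ : ℝ → ℝ) (t : ℝ) : ℝ := φ (toIocMod Real.two_pi_pos (-π) t)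

lemma periodize_periodic (φ : ℝ → ℝ) : Function.Periodic (periodize φ) (2 * π) := fun t => by
  unfold periodize
  rw [toIocMod_periodic]

lemma periodize_eq {φ : ℝ → ℝ} {t : ℝ} (ht : t ∈ Set.Ioc (-π) π) : periodize φ t = φ t := by
  unfold periodize
  rw [(toIocMod_eq_self _).2]
  rwa [show -π + 2 * π = π by ring]

/-- The class demands periodicity, but the integrals only see `(-π, π]`. -/
lemma integral_mul_periodize (g φ : ℝ → ℝ) :
    ∫ t in (-π)..π, g t * periodize φ t = ∫ t in (-π)..π, g t * φ t := by
  have hpi := Real.pi_pos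
  refine intervalIntegral.integral_congr_ae (ae_of_all _ fun t ht => ?_)
  rw [Set.uIoc_of_le (by linarith)] at ht
  rw [periodize_eq ht]

lemma periodize_mem_zeroMeanBall {φ : ℝ → ℝ} (hm : Measurable φ) (hb : ∀ t, |φ t| ≤ 1)
    (h0 : ∫ t in (-π)..π, φ t = 0) : periodize φ ∈ zeroMeanBall ⊤ := by
  refine ⟨periodize_periodic φ, ?_, ?_, ?_⟩
  · refine hm.aestronglyMeasurable.congr ?_
    filter_upwards [ae_restrict_mem measurableSet_Ioc] with t ht
    exact (periodize_eq ht).symm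
  · rw [eLpNorm_exponent_top]
    refine eLpNormEssSup_le_of_ae_enorm_bound (ae_of_all _ fun t => ?_)
    rw [Real.enorm_eq_ofReal_abs]
    exact ENNReal.ofReal_le_one.2 (hb _)
  · have := integral_mul_periodize (fun _ => 1) φ
    simp only [one_mul] at this
    rw [this, h0]

/-! ### Two-sided bounds for the error -/

section Main

variable {α r : ℝ} {n : ℕ}

lemma tailKernel_ratio_near_sin (hα : 0 < α) (hr : 0 < r) (hr1 : r < 1) (hn : 1 ≤ n)
    (hp : 2 ≤ α * r * (n : ℝ) ^ r) (θ : ℝ) {t : ℝ} (h0 : 0 < t) (hπ : t ≤ π) :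
    |tailKernel (ratio α r n) n θ t + Real.sin (((n : ℝ) - 1 / 2) * t - θ) / t| ≤
      π ^ 2 / (2 * ((n : ℝ) ^ (1 - r) / (α * r))) * (1 / t ^ 2) + 1 :=
  abs_tailKernel_add_div_le (summable_ratio hα hr hn hp) (ratio_succ_le hα hr n)
    (ratio_convex hα hr hr1 n) (ratio_zero α r n) (ratio_zero_sub_one_le hα hr hr1 hn) n θ h0 hπ

lemma abs_tailKernel_ratio_le (hα : 0 < α) (hr : 0 < r) (hn : 1 ≤ n)
    (hp : 2 ≤ α * r * (n : ℝ) ^ r) (θ t : ℝ) :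
    |tailKernel (ratio α r n) n θ t| ≤ 1 + 2 * ((n : ℝ) ^ (1 - r) / (α * r)) :=
  (abs_tailKernel_le (summable_ratio hα hr hn hp) (ratio_nonneg α r n) n θ t).trans
    (tsum_ratio_le hα hr hn hp)

/-- Here `n = pM ≥ 100M`, which leaves ample room for the shift by `1/2`. -/
lemma le_frequency (hα : 0 < α) (hr : 0 < r) (hn : 1 ≤ n) (hp : 100 ≤ α * r * (n : ℝ) ^ r)
    (hM : 100 ≤ (n : ℝ) ^ (1 - r) / (α * r)) :
    10 * ((n : ℝ) ^ (1 - r) / (α * r)) ≤ (n : ℝ) - 1 / 2 := by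
  have hn0 : (0 : ℝ) < n := by exact_mod_cast hn
  have hpM : (α * r * (n : ℝ) ^ r) * ((n : ℝ) ^ (1 - r) / (α * r)) = n := by
    have : (n : ℝ) ^ r * (n : ℝ) ^ (1 - r) = n := by
      rw [← Real.rpow_add hn0]; simp
    field_simp
    linarith
  nlinarith

/-- As `|φ| ≤ 1`, the L¹ norm of the kernel is a bound; periodicity removes `x`, and reflection
turns the negative half-period into the positive one with phase `-θ`. -/
lemma abs_integral_tailKernel_mul_le (hα : 0 < α) (hr : 0 < r) (hr1 : r < 1) (hn : 1 ≤ n)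
    (hp : 100 ≤ α * r * (n : ℝ) ^ r) (hM : 100 ≤ (n : ℝ) ^ (1 - r) / (α * r)) (θ x : ℝ)
    {φ : ℝ → ℝ} (hφ : φ ∈ zeroMeanBall ⊤) :
    |∫ t in (-π)..π, tailKernel (ratio α r n) n θ (x - t) * φ t| ≤
      4 / π * Real.log (π * ((n : ℝ) ^ (1 - r) / (α * r))) + 26 := by
  have hpi := Real.pi_pos
  have hp2 : 2 ≤ α * r * (n : ℝ) ^ r := by linarith
  have hK := continuous_tailKernel (summable_ratio hα hr hn hp2) n
  have hhalf := fun θ => integral_abs_le_of_near_sin (hK θ) (by linarith)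
    (le_frequency hα hr hn hp hM) (abs_tailKernel_ratio_le hα hr hn hp2 θ)
    (fun t h0 hπ => tailKernel_ratio_near_sin hα hr hr1 hn hp2 θ h0 hπ)
  set K := tailKernel (ratio α r n) n
  have hshift : ∫ t in (-π)..π, |K θ (x - t)| = ∫ t in (-π)..π, |K θ t| := by
    rw [intervalIntegral.integral_comp_sub_left (fun t => |K θ t|) x]
    have hper : Function.Periodic (fun t => |K θ t|) (2 * π) :=
      (tailKernel_periodic (ratio α r n) n θ).comp fun y => |y|
    have := hper.intervalIntegral_add_eq (x - π) (-π)
    rwa [show x - π + 2 * π = x - -π by ring, show -π + 2 * π = π by ring] at this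
  have h1 : |∫ t in (-π)..π, K θ (x - t) * φ t| ≤ ∫ t in (-π)..π, |K θ (x - t)| := by
    rw [← Real.norm_eq_abs]
    refine intervalIntegral.norm_integral_le_of_norm_le (by linarith) ?_
      (((hK θ).comp (by fun_prop : Continuous fun t => x - t)).abs.intervalIntegrable _ _)
    have := (ae_restrict_iff' measurableSet_Ioc).1 (zeroMeanBall_top hφ).2
    filter_upwards [this] with t ht htm
    rw [norm_mul, Real.norm_eq_abs, Real.norm_eq_abs]
    exact mul_le_of_le_one_right (abs_nonneg _) (ht htm)
  refine h1.trans ?_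
  rw [hshift, integral_neg_pi_pi_eq ((hK θ).abs.intervalIntegrable _ _)]
  have h2 : ∀ t, K θ (-t) = K (-θ) t := tailKernel_neg _ n θ
  simp_rw [h2]
  have h3 := hhalf θ
  have h4 := hhalf (-θ)
  have h5 : 4 / π * Real.log (π * ((n : ℝ) ^ (1 - r) / (α * r))) =
      2 * (2 / π * Real.log (π * ((n : ℝ) ^ (1 - r) / (α * r)))) := by ring
  linarith

lemma exists_le_integral_tailKernel_mul (hα : 0 < α) (hr : 0 < r) (hr1 : r < 1) (hn : 1 ≤ n)
    (hp : 100 ≤ α * r * (n : ℝ) ^ r) (hM : 100 ≤ (n : ℝ) ^ (1 - r) / (α * r)) (θ : ℝ) :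
    ∃ φ ∈ zeroMeanBall ⊤, 4 / π * Real.log (π * ((n : ℝ) ^ (1 - r) / (α * r))) - 26 ≤
      ∫ t in (-π)..π, tailKernel (ratio α r n) n θ (0 - t) * φ t := by
  have hpi := Real.pi_gt_three
  have hp2 : 2 ≤ α * r * (n : ℝ) ^ r := by linarith
  have hK := continuous_tailKernel (summable_ratio hα hr hn hp2) n
  have hN := le_frequency hα hr hn hp hM
  have hhalf := fun θ (φ : ℝ → ℝ) => le_integral_mul_of_near_sin (φ := φ) (hK θ) (by linarith)
    hN (abs_tailKernel_ratio_le hα hr hn hp2 θ)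
    (fun t h0 hπ => tailKernel_ratio_near_sin hα hr hr1 hn hp2 θ h0 hπ)
  have hKM := abs_tailKernel_ratio_le (n := n) hα hr hn hp2
  set K := tailKernel (ratio α r n) n with hKdef
  set M := (n : ℝ) ^ (1 - r) / (α * r)
  set N := (n : ℝ) - 1 / 2
  have hδ : 0 < 1 / M := by positivity
  have hδπ : 1 / M ≤ π := by
    have : 1 / M ≤ 1 := by rw [div_le_one (by linarith)]; linarith
    linarith
  obtain ⟨κ, hκ, hzero⟩ := exists_integral_extremalSign_eq_zero (N := N) θ hδ hδπ (by
    rw [mul_one_div, le_div_iff₀ (by linarith)]; exact hN)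
  set φ := extremalSign N θ (1 / M) κ with hφ
  have hφm : Measurable φ := measurable_extremalSign _ _ _ _
  have hφb : ∀ t, |φ t| ≤ 1 := abs_extremalSign_le hκ _ _ _
  refine ⟨periodize φ, periodize_mem_zeroMeanBall hφm hφb hzero, ?_⟩
  rw [integral_mul_periodize]
  simp_rw [zero_sub]
  have hint : IntervalIntegrable (fun t => K θ (-t) * φ t) volume (-π) π := by
    refine intervalIntegrable_of_abs_le (C := 1 + 2 * M)
      (((hK θ).comp continuous_neg).measurable.mul hφm) (fun t => ?_) _ _
    change |K θ (-t) * φ t| ≤ _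
    rw [abs_mul]
    calc |K θ (-t)| * |φ t| ≤ |K θ (-t)| * 1 := by gcongr; exact hφb t
      _ ≤ _ := by rw [mul_one]; exact hKM θ _
  rw [integral_neg_pi_pi_eq hint]
  simp_rw [neg_neg]
  have h2 : ∀ t, K θ (-t) = K (-θ) t := tailKernel_neg _ n θ
  simp_rw [h2]
  -- At `x = 0` the kernel is evaluated at `-t`, so positive `t` meets phase `-θ` and negative `t`
  -- meets phase `θ`, as in `extremalSign`.
  have h3 := hhalf (-θ) φ hφm hφb fun t ht _ => by
    rw [hφ, extremalSign_of_nonneg (hδ.le.trans ht)]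
    exact if_pos ht
  have h4 := hhalf θ (fun t => φ (-t)) (hφm.comp measurable_neg) (fun t => hφb _)
    fun t ht _ => by
      simp only [hφ]
      rw [extremalSign_neg hδ (hδ.le.trans ht)]
      exact if_pos ht
  have h5 : 4 / π * Real.log (π * M) = 2 * (2 / π * Real.log (π * M)) := by ring
  linarith

lemma fourierError_le (hα : 0 < α) (hr : 0 < r) (hr1 : r < 1) (β : ℝ) (hn : 1 ≤ n)
    (hp : 100 ≤ α * r * (n : ℝ) ^ r) (hM : 100 ≤ (n : ℝ) ^ (1 - r) / (α * r)) :
    fourierError α r β ⊤ n ≤ ENNReal.ofReal (Real.exp (-α * (n : ℝ) ^ r) *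
      (1 / π * (4 / π * Real.log (π * ((n : ℝ) ^ (1 - r) / (α * r))) + 26))) := by
  refine iSup₂_le fun f hf => iSup_le fun x => ENNReal.ofReal_le_ofReal ?_
  obtain ⟨a₀, φ, hφ, hf⟩ := hf
  have hs := summable_ratio hα hr hn (by linarith)
  change |f x - fourierSum (n - 1) f x| ≤ _
  rw [sub_fourierSum_eq hn hs (zeroMeanBall_top hφ).1 hf x, abs_mul, abs_mul,
    abs_of_pos (Real.exp_pos _), abs_of_pos (by positivity : 0 < 1 / π)]
  gcongr
  exact abs_integral_tailKernel_mul_le hα hr hr1 hn hp hM _ x hφ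

lemma le_fourierError (hα : 0 < α) (hr : 0 < r) (hr1 : r < 1) (β : ℝ) (hn : 1 ≤ n)
    (hp : 100 ≤ α * r * (n : ℝ) ^ r) (hM : 100 ≤ (n : ℝ) ^ (1 - r) / (α * r)) :
    ENNReal.ofReal (Real.exp (-α * (n : ℝ) ^ r) *
      (1 / π * (4 / π * Real.log (π * ((n : ℝ) ^ (1 - r) / (α * r))) - 26))) ≤
      fourierError α r β ⊤ n := by
  obtain ⟨φ, hφ, hle⟩ := exists_le_integral_tailKernel_mul hα hr hr1 hn hp hM (β * π / 2)
  have hs := summable_ratio hα hr hn (by linarith)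
  set f : ℝ → ℝ := fun x => 0 / 2 + 1 / π * ∫ t in (-π)..π, poissonKernel α r β (x - t) * φ t
    with hfdef
  have hf : f ∈ poissonClass α r β ⊤ := ⟨0, φ, hφ, fun x => rfl⟩
  refine le_trans ?_ (le_iSup₂ (f := fun f (_ : f ∈ poissonClass α r β ⊤) =>
    uniformNorm (fun x => f x - fourierSum (n - 1) f x)) f hf)
  refine le_trans ?_ (le_iSup (fun x : ℝ => ENNReal.ofReal |f x - fourierSum (n - 1) f x|) 0)
  refine ENNReal.ofReal_le_ofReal (le_trans ?_ (le_abs_self _))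
  rw [sub_fourierSum_eq hn hs (zeroMeanBall_top hφ).1 (fun x => rfl) 0]
  gcongr

end Main

end FourierApprox

theorem theorem3 (α r β : ℝ) (hα : 0 < α) (hr : 0 < r) (hr1 : r < 1)
    (n : ℕ) (hn : FourierApprox.threshold α r ≤ n) :
    ∃ γ : ℝ, |γ| ≤ 20 * Real.pi ^ 4 ∧
      FourierApprox.fourierError α r β ⊤ n ≠ ⊤ ∧
      (FourierApprox.fourierError α r β ⊤ n).toReal =
        4 / Real.pi ^ 2 * Real.exp (-α * (n : ℝ) ^ r) *
            Real.log (Real.pi * (n : ℝ) ^ (1 - r) / (α * r)) +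
          γ * Real.exp (-α * (n : ℝ) ^ r) := by
  obtain ⟨hn1, hp, hM⟩ := FourierApprox.le_of_threshold_le hα hr hr1 hn
  have hup := FourierApprox.fourierError_le hα hr hr1 β hn1 hp hM
  have hlo := FourierApprox.le_fourierError hα hr hr1 β hn1 hp hM
  rw [← mul_div_assoc] at hup hlo
  have hpi := Real.pi_gt_three
  -- This makes the upper bound nonnegative, as its passage from `ENNReal.ofReal` to the reals
  -- requires.
  have hlog : 0 ≤ Real.log (π * (n : ℝ) ^ (1 - r) / (α * r)) := by
    rw [mul_div_assoc]
    exact Real.log_nonneg (by nlinarith)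
  have htop : FourierApprox.fourierError α r β ⊤ n ≠ ⊤ := (hup.trans_lt ENNReal.ofReal_lt_top).ne
  have hexp := Real.exp_pos (-α * (n : ℝ) ^ r)
  have hup' := ENNReal.toReal_le_of_le_ofReal (by positivity) hup
  have hlo' := (ENNReal.ofReal_le_iff_le_toReal htop).1 hlo
  set E := (FourierApprox.fourierError α r β ⊤ n).toReal
  set L := Real.log (π * (n : ℝ) ^ (1 - r) / (α * r))
  set e := Real.exp (-α * (n : ℝ) ^ r)
  have h1 : e * (1 / π * (4 / π * L + 26)) = 4 / π ^ 2 * e * L + 26 / π * e := by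
    field_simp
  have h2 : e * (1 / π * (4 / π * L - 26)) = 4 / π ^ 2 * e * L - 26 / π * e := by
    field_simp
  rw [h1] at hup'
  rw [h2] at hlo'
  have hpi4 : 26 / π ≤ 20 * π ^ 4 := by
    have h3 : (3 : ℝ) ^ 4 ≤ π ^ 4 := by gcongr
    have h4 : 26 / π ≤ 26 := div_le_self (by norm_num) (by linarith)
    linarith
  -- This `γ` is forced by the asserted identity; the two bounds give `|γ| ≤ 26/π`, far below
  -- `20π⁴`.
  refine ⟨(E - 4 / π ^ 2 * e * L) / e, le_trans ?_ hpi4, htop, ?_⟩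
  · rw [abs_div, abs_of_pos hexp, div_le_iff₀ hexp, abs_le]
    constructor <;> linarith
  · field_simp
    ring
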